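/- **Setting.** Let $P$ be a probability measure on $[0,1]\times[-M,M]$, the law of $(X,Y)$. Let $G_X$ denote the marginal law of $X$, assumed known and without atoms, and also its (continuous) distribution function. Let $f(x)=\mathbb E(Y\mid X=x)$ be the regression function, and let $\mathbf z=\{(x_i,y_i)\}_{i\le n}$ be an i.i.d. sample from $P$. Write $\|\cdot\|$ for the norm of $L^2(G_X)$. **Warped wavelets.** Let $\varphi,\psi:\mathbb R\to\mathbb R$ be bounded, measurable, compactly supported functions such that the 1-periodised functions $\psi_{-1}(y)=\sum_{l\in\mathbb Z}\varphi(y+l)$ and $\psi_{j,k}(y)=\sum_{l\in\mathbb Z}2^{j/2}\psi(2^j(y+l)-k)$, $j\ge 0$, $0\le k<2^j$, form an orthonormal basis of $L^2([0,1],dy)$. For an index $I$ (either $-1$ or $(j,k)$) put $$d_I=\langle f,\psi_I(G_X)\rangle_{L^2(G_X)},\qquad d_I(\mathbf z)=\frac1n\sum_{i=1}^n y_i\,\psi_I(G_X(x_i)).$$ **Trees.** Identify $(j,k)$, $0\le k<2^j$, with the dyadic interval $[2^{-j}k,2^{-j}(k+1)]$; its children $\mathcal C(I)$ are its two halves. A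 tree is a set of nodes that contains, with each node, all its ancestors. The outer leaves of a finite tree $\mathcal T$ are the nodes outside $\mathcal T$ whose parent is in $\mathcal T$ (for the empty tree, the only outer leaf is the root). Let $\overline{\mathcal T}$ be $\mathcal T$ together with its outer leaves, and put $$\Pi_{\mathcal T}f=d_{-1}\psi_{-1}(G_X)+\sum_{I\in\overline{\mathcal T}}d_I\psi_I(G_X).$$ Let $\mathcal T_J$ be the tree of all nodes of level $<J$. The residuals are $$\nu_I=\Big(\sum_{I'\in\mathcal C(I)}d_{I'}^2\Big)^{1/2},\qquad \nu_I(\mathbf z)=\Big(\sum_{I'\in\mathcal C(I)}d_{I'}(\mathbf z)^2\Big)^{1/2}.$$ For $\lambda>0$, let $\mathcal T(f,\lambda)$ be the set of nodes that contain a node $I$ with $\nu_I\ge\lambda$. **Approximation spaces.** $f\in\mathcal A^\gamma$ means $f\in L^2(G_X)$ and $\sup_{J\ge0}2^{J\gamma}\|f-\Pi_{\mathcal T_J}f\|<\infty$. $f\in\mathcal B^s$ means $f\in L^2(G_X)$ and $\sup_{\lambda>0}\lambda^p\,\mathrm{card}\,\mathcal T(f,\lambda)<\infty$, where $p=(s+\frac12)^{-1}$.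 **Estimator.** For $\kappa>0$ let $\lambda_n=\kappa\sqrt{\log n/n}$, and let $J^\star$ be the largest $j\in\mathbb N_0$ with $2^j\le\lambda_n^{-1/\gamma}$ ($J^\star=0$ if there is none). Let $\mathcal T(\mathbf z,n)$ be the set $\{I\in\mathcal T_{J^\star}:\nu_I(\mathbf z)\ge\lambda_n\}$ completed to a tree by adding all ancestors, and let $$f_{\mathbf z}=d_{-1}(\mathbf z)\psi_{-1}(G_X)+\sum_{I\in\overline{\mathcal T(\mathbf z,n)}}d_I(\mathbf z)\psi_I(G_X).$$ **Theorem 2 (Optimality for "growing" adaptive partitions).** Fix $\varphi,\psi$ and $M$ as above, and let $\beta\in\mathbb R$ and $\gamma\ge\frac12$ be arbitrary. There exists $\kappa>0$ such that for every $P$ as above and every $s>0$ with $f\in\mathcal A^\gamma\cap\mathcal B^s$ there are constants $\tilde c,C>0$, not depending on $n$, such that for all $n\ge2$ $$P^{\otimes n}\Big\{\|f-f_{\mathbf z}\|>\tilde c\Big(\frac{\log n}{n}\Big)^{\frac{s}{2s+1}}\Big\}\le C\,n^{-\beta},\qquad \mathbb E^{\otimes n}\|f-f_{\mathbf z}\|^2\le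 C\Big(\frac{\log n}{n}\Big)^{\frac{2s}{2s+1}}.$$ The estimator is adaptive: neither $\kappa$ nor $f_{\mathbf z}$ depends on $s$. -/

import Mathlib

open MeasureTheory ProbabilityTheory
open scoped ENNReal

noncomputable section

namespace WarpedWavelet

/-! ### Dyadic nodes and trees

The node `(j, k)` with `k < 2 ^ j` stands for the dyadic interval `[2⁻ʲ k, 2⁻ʲ (k + 1)]`. -/

/-- The two children (halves) of a dyadic interval. -/
def children (p : ℕ × ℕ) : Finset (ℕ × ℕ) :=
  {(p.1 + 1, 2 * p.2), (p.1 + 1, 2 * p.2 + 1)}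

/-- `IsBelow q p`: the dyadic interval `q` is contained in the dyadic interval `p`. -/
def IsBelow (q p : ℕ × ℕ) : Prop :=
  p.1 ≤ q.1 ∧ q.2 / 2 ^ (q.1 - p.1) = p.2

/-- The tree of all nodes of level `< J`. -/
def levelTree (J : ℕ) : Finset (ℕ × ℕ) :=
  (Finset.range J ×ˢ Finset.range (2 ^ J)).filter fun p => p.2 < 2 ^ p.1

/-- The outer leaves of a finite tree `T`: the nodes outside `T` whose parent is in `T`.
The only outer leaf of the empty tree is the root. They form the dyadic partition
associated with `T`. -/
def outerLeaves (T : Finset (ℕ × ℕ)) : Finset (ℕ × ℕ) :=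
  insert (0, 0) (T.biUnion children) \ T

/-! ### Wavelets on `[0,1]` -/

/-- The `1`-periodised wavelet system. The index `none` is the scaling function, and
`some (j, k)` is the wavelet `2^{j/2} ψ(2ʲ y - k)`. For compactly supported `φ`, `ψ` all
the sums have finitely many nonzero terms. -/
def wavelet (φ ψ : ℝ → ℝ) : Option (ℕ × ℕ) → ℝ → ℝ
  | none, y => ∑' l : ℤ, φ (y + l)
  | some p, y => ∑' l : ℤ, (2 : ℝ) ^ ((p.1 : ℝ) / 2) * ψ ((2 : ℝ) ^ p.1 * (y + l) - p.2)

/-- The indices that occur: the scaling function and the wavelets with `0 ≤ k < 2 ^ j`. -/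
def IsIndex : Option (ℕ × ℕ) → Prop
  | none => True
  | some p => p.2 < 2 ^ p.1

/-- `φ` and `ψ` are bounded, compactly supported, and generate an orthonormal wavelet
basis of `L²([0,1], dy)`. -/
structure IsWaveletBasis (φ ψ : ℝ → ℝ) : Prop where
  measurable_scaling : Measurable φ
  measurable_mother : Measurable ψ
  bounded_scaling : ∃ B : ℝ, ∀ y, |φ y| ≤ B
  bounded_mother : ∃ B : ℝ, ∀ y, |ψ y| ≤ B
  compact_scaling : HasCompactSupport φ
  compact_mother : HasCompactSupport ψ
  orthonormal : ∀ a b, IsIndex a → IsIndex b →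
    ∫ y in Set.Icc (0 : ℝ) 1, wavelet φ ψ a y * wavelet φ ψ b y = if a = b then 1 else 0
  complete : ∀ h : ℝ → ℝ, MemLp h 2 (volume.restrict (Set.Icc (0 : ℝ) 1)) →
    (∀ a, IsIndex a → ∫ y in Set.Icc (0 : ℝ) 1, h y * wavelet φ ψ a y = 0) →
    h =ᵐ[volume.restrict (Set.Icc (0 : ℝ) 1)] 0

/-- The warped system `x ↦ ψ_a(G(x))`, where `G` is the distribution function of `μ`. -/
def warped (φ ψ : ℝ → ℝ) (μ : Measure ℝ) (a : Option (ℕ × ℕ)) (x : ℝ) : ℝ :=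
  wavelet φ ψ a (cdf μ x)

/-! ### Tree-structured expansions and approximation spaces -/

/-- The warped expansion with coefficients `d` on the partition associated with `T`: the
scaling term, and all wavelets attached to intervals that contain a cell of the partition,
that is, to the nodes of `T` and its outer leaves. -/
def treeSum (φ ψ : ℝ → ℝ) (μ : Measure ℝ) (d : Option (ℕ × ℕ) → ℝ) (T : Finset (ℕ × ℕ))
    (x : ℝ) : ℝ :=
  d none * warped φ ψ μ none x +
    ∑ p ∈ T ∪ outerLeaves T, d (some p) * warped φ ψ μ (some p) x

/-- The residual of a node: the `ℓ²` energy that the expansion gains when it is refined. -/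
def residual (d : Option (ℕ × ℕ) → ℝ) (p : ℕ × ℕ) : ℝ :=
  Real.sqrt (∑ q ∈ children p, d (some q) ^ 2)

/-- The coefficients of `f` in the warped basis, `⟨f, ψ_a(G)⟩` in `L²(μ)`. -/
def coeff (φ ψ : ℝ → ℝ) (μ : Measure ℝ) (f : ℝ → ℝ) (a : Option (ℕ × ℕ)) : ℝ :=
  ∫ x, f x * warped φ ψ μ a x ∂μ

/-- The tree `𝒯(f, lam)`: all nodes that contain a node with residual at least `lam`. -/
def residualTree (φ ψ : ℝ → ℝ) (μ : Measure ℝ) (f : ℝ → ℝ) (lam : ℝ) : Set (ℕ × ℕ) :=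
  {p | ∃ q : ℕ × ℕ, q.2 < 2 ^ q.1 ∧ IsBelow q p ∧ lam ≤ residual (coeff φ ψ μ f) q}

/-- The approximation space `𝒜^γ` (uniform partitions). -/
def MemA (φ ψ : ℝ → ℝ) (μ : Measure ℝ) (γ : ℝ) (f : ℝ → ℝ) : Prop :=
  MemLp f 2 μ ∧ ∃ M₀ : ℝ, ∀ J : ℕ,
    eLpNorm (fun x => f x - treeSum φ ψ μ (coeff φ ψ μ f) (levelTree J) x) 2 μ
      ≤ ENNReal.ofReal (M₀ * (2 : ℝ) ^ (-(J * γ)))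

/-- The approximation space `ℬ^s` (adaptive partitions):
`sup_{lam > 0} lam ^ p * card 𝒯(f, lam) < ∞` with `p = (s + 1/2)⁻¹`. -/
def MemB (φ ψ : ℝ → ℝ) (μ : Measure ℝ) (s : ℝ) (f : ℝ → ℝ) : Prop :=
  MemLp f 2 μ ∧ ∃ C : ℝ, ∀ lam : ℝ, 0 < lam →
    (residualTree φ ψ μ f lam).Finite ∧
      lam ^ (s + 1 / 2)⁻¹ * ((residualTree φ ψ μ f lam).ncard : ℝ) ≤ C

/-! ### The estimator -/

/-- The empirical coefficients `d_a(z) = n⁻¹ ∑ᵢ yᵢ ψ_a(G(xᵢ))`. -/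
def empCoeff (φ ψ : ℝ → ℝ) (μ : Measure ℝ) {n : ℕ} (z : Fin n → ℝ × ℝ)
    (a : Option (ℕ × ℕ)) : ℝ :=
  (n : ℝ)⁻¹ * ∑ i, (z i).2 * warped φ ψ μ a (z i).1

/-- The threshold `κ √(log n / n)`. -/
def threshold (κ : ℝ) (n : ℕ) : ℝ := κ * Real.sqrt (Real.log n / n)

/-- The largest `j` with `2 ^ j ≤ lam ^ (-1/γ)` (and `0` if there is none). -/
def truncLevel (γ lam : ℝ) : ℕ := sSup {j : ℕ | (2 : ℝ) ^ j ≤ lam ^ (-1 / γ)}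

open Classical in
/-- The empirical tree: the nodes of level `< J` whose residual is at least `lam`, completed
to a tree by all their ancestors. -/
def empTree (φ ψ : ℝ → ℝ) (μ : Measure ℝ) {n : ℕ} (z : Fin n → ℝ × ℝ) (lam : ℝ) (J : ℕ) :
    Finset (ℕ × ℕ) :=
  (levelTree J).filter fun p =>
    ∃ q ∈ levelTree J, IsBelow q p ∧ lam ≤ residual (empCoeff φ ψ μ z) q

/-- The vertically thresholded warped wavelet estimator. -/
def estimator (φ ψ : ℝ → ℝ) (μ : Measure ℝ) (κ γ : ℝ) {n : ℕ} (z : Fin n → ℝ × ℝ) :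
    ℝ → ℝ :=
  treeSum φ ψ μ (empCoeff φ ψ μ z)
    (empTree φ ψ μ z (threshold κ n) (truncLevel γ (threshold κ n)))

/-- `f` is (a version of) the regression function `x ↦ E(Y | X = x)` for `(X, Y) ∼ P`. -/
def IsRegressionFunction (P : Measure (ℝ × ℝ)) (f : ℝ → ℝ) : Prop :=
  Measurable f ∧
    (fun z : ℝ × ℝ => f z.1) =ᵐ[P]
      P[(Prod.snd : ℝ × ℝ → ℝ) | MeasurableSpace.comap Prod.fst inferInstance]

end WarpedWavelet

end

namespace WarpedWavelet

/-! ### The distribution function pushes an atomless law to the uniform law -/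

/-! Since `μ` has no atoms, its distribution function `G` pushes it to the uniform law (`map_cdf`).
The warped wavelets are therefore orthonormal in `L²(μ)`, and norms of finite expansions are `ℓ²`
norms of coefficients.

For any tree inside `levelTree J`, the error splits into three parts: the bias of the uniform
partition of level `J`, the residual energy of the nodes left out, and the coefficient errors on the
nodes kept (`eLpNorm_sub_treeSum_le`). Suppose that all empirical coefficients up to level `J` are
within `λ/4` of the true ones. Residuals then move by at most `λ/2`, with two consequences. The
empirical tree lies in `𝒯(f, λ/2)`, so it has `O(λ^(-p))` nodes and the coefficient errors add up to
`O(λ^2 + λ^(2-p))` in squared norm. The nodes left out have true residual below `2λ`, and slicing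
these residuals dyadically, with the `ℬ^s` bound on each slice, gives `O(λ^(2-p))` again
(`sum_sq_filter_lt_le`). The choice of `J` makes the uniform bias `O(λ)`. Since `2 - p = 4s/(2s+1)`
and `λ` is of order `√(log n / n)`, the total is the claimed rate.

The good event is likely by Bernstein's inequality. Each summand has second moment at most `K²` at
every level, by orthonormality, and is bounded by a multiple of `2^(J/2)`. Because `γ ≥ 1/2`, this
is `O(1/min(λ,1))`, so the deviation `λ/4` stays in the Gaussian regime and has probability
`O(n^(-b))` once `κ` is proportional to `b`. Only `O(n²)` coefficients are involved, so a union
bound suffices. For the expectation, the polynomial bound `eLpNorm_sub_estimator_le` is used on the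
bad event. -/

lemma continuous_cdf (μ : Measure ℝ) [IsProbabilityMeasure μ] [NullSingletonClass μ] :
    Continuous (cdf μ) := by
  refine continuous_iff_continuousAt.2 fun x => ?_
  rw [(cdf μ).mono.continuousAt_iff_leftLim_eq_rightLim, StieltjesFunction.rightLim_eq]
  have h : μ {x} = 0 := measure_singleton x
  rw [← measure_cdf μ, StieltjesFunction.measure_singleton, ENNReal.ofReal_eq_zero] at h
  exact le_antisymm ((cdf μ).mono.leftLim_le le_rfl) (by linarith)

lemma exists_cdf_eq (μ : Measure ℝ) [IsProbabilityMeasure μ] [NullSingletonClass μ] {t : ℝ}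
    (h0 : 0 < t) (h1 : t < 1) : ∃ x, cdf μ x = t := by
  obtain ⟨a, ha⟩ := ((tendsto_cdf_atBot μ).eventually (gt_mem_nhds h0)).exists
  obtain ⟨b, hb⟩ := ((tendsto_cdf_atTop μ).eventually (lt_mem_nhds h1)).exists
  exact mem_range_of_exists_le_of_exists_ge (continuous_cdf μ) ⟨a, ha.le⟩ ⟨b, hb.le⟩

/-- For `cdf μ x = t`, the set `{cdf μ ≤ t}` contains `Iic x`, of mass `t`. It may be larger, since
the distribution function can be flat at height `t`; the upper bound is therefore taken at a height
`t' > t`, and `t'` decreases to `t`. -/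
lemma map_cdf (μ : Measure ℝ) [IsProbabilityMeasure μ] [NullSingletonClass μ] :
    μ.map (cdf μ) = volume.restrict (Set.Icc (0 : ℝ) 1) := by
  have hm : Measurable (cdf μ) := (continuous_cdf μ).measurable
  have hI : (volume.restrict (Set.Icc (0 : ℝ) 1)) Set.univ = 1 := by simp
  have : IsProbabilityMeasure (volume.restrict (Set.Icc (0 : ℝ) 1)) := ⟨hI⟩
  have : IsProbabilityMeasure (μ.map (cdf μ)) := Measure.isProbabilityMeasure_map hm.aemeasurable
  have upper : ∀ t t' : ℝ, 0 < t' → t < t' → μ {x | cdf μ x ≤ t} ≤ ENNReal.ofReal t' := by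
    intro t t' h0 htt
    rcases lt_or_ge t' 1 with h1 | h1
    · obtain ⟨x, hx⟩ := exists_cdf_eq μ h0 h1
      rw [← hx, ofReal_cdf]
      refine measure_mono fun y hy => ?_
      by_contra hlt
      have := (cdf μ).mono (not_le.1 hlt).le
      simp only [Set.mem_ofPred_eq] at hy
      linarith
    · exact prob_le_one.trans (by simpa using h1)
  refine Measure.ext_of_Iic _ _ fun t => ?_
  rw [Measure.map_apply hm measurableSet_Iic, Measure.restrict_apply measurableSet_Iic]
  change μ {x | cdf μ x ≤ t} = _
  rcases lt_or_ge t 0 with h | h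
  · have e1 : {x | cdf μ x ≤ t} = ∅ := by
      ext x; simpa using h.trans_le (cdf_nonneg μ x)
    have e2 : Set.Iic t ∩ Set.Icc (0 : ℝ) 1 = ∅ := by
      ext x; simp only [Set.mem_inter_iff, Set.mem_Iic, Set.mem_Icc, Set.mem_empty_iff_false,
        iff_false]; intro hx; linarith [hx.1, hx.2.1]
    rw [e1, e2]; simp
  rcases le_or_gt 1 t with h1 | h1
  · have e1 : {x | cdf μ x ≤ t} = Set.univ := by
      ext x; simpa using (cdf_le_one μ x).trans h1
    have e2 : Set.Iic t ∩ Set.Icc (0 : ℝ) 1 = Set.Icc 0 1 :=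
      Set.inter_eq_right.2 fun x hx => hx.2.trans h1
    rw [e1, e2]; simp
  have e2 : Set.Iic t ∩ Set.Icc (0 : ℝ) 1 = Set.Icc 0 t := by
    ext x; simp only [Set.mem_inter_iff, Set.mem_Iic, Set.mem_Icc]
    constructor
    · rintro ⟨a, b, c⟩; exact ⟨b, a⟩
    · rintro ⟨a, b⟩; exact ⟨b, a, b.trans h1.le⟩
  rw [e2, Real.volume_Icc, sub_zero]
  refine le_antisymm ?_ ?_
  · refine ENNReal.le_of_forall_pos_le_add fun ε hε _ => ?_
    refine (upper t (t + ε) (by positivity) (by simpa using hε)).trans ?_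
    refine ENNReal.ofReal_add_le.trans ?_
    simp
  · rcases h.eq_or_lt with h0 | h0
    · simp [← h0]
    · obtain ⟨x, hx⟩ := exists_cdf_eq μ h0 h1
      conv_lhs => rw [← hx, ofReal_cdf]
      refine measure_mono fun y hy => ?_
      have := (cdf μ).mono hy
      simp only [Set.mem_ofPred_eq]
      linarith

/-! ### Size and measurability of the periodised wavelets -/

/-- The level of an index; the scaling function has level `0`. -/
def level : Option (ℕ × ℕ) → ℕ
  | none => 0
  | some p => p.1

/-- The summands of the periodised wavelets. -/
noncomputable def waveletTerm (φ ψ : ℝ → ℝ) : Option (ℕ × ℕ) → ℤ → ℝ → ℝ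
  | none, l, y => φ (y + l)
  | some p, l, y => (2 : ℝ) ^ ((p.1 : ℝ) / 2) * ψ ((2 : ℝ) ^ p.1 * (y + l) - p.2)

lemma measurable_waveletTerm {φ ψ : ℝ → ℝ} (hφ : Measurable φ) (hψ : Measurable ψ)
    (a : Option (ℕ × ℕ)) (l : ℤ) : Measurable (waveletTerm φ ψ a l) := by
  cases a with
  | none => exact hφ.comp (measurable_id.add_const _)
  | some p =>
    exact (hψ.comp (((measurable_id.add_const _).const_mul _).sub_const _)).const_mul _

lemma exists_support_bound {φ : ℝ → ℝ} (h : HasCompactSupport φ) :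
    ∃ R : ℝ, 0 ≤ R ∧ ∀ y, R < |y| → φ y = 0 := by
  obtain ⟨R, hR⟩ := h.isCompact.isBounded.exists_norm_le
  refine ⟨max R 0, le_max_right _ _, fun y hy => ?_⟩
  by_contra hne
  have := hR y (subset_tsupport _ hne)
  rw [Real.norm_eq_abs] at this
  linarith [le_max_left R 0]

/-- One finite set of translates serves all indices: with `y ∈ [0,1]` and `k < 2^j`, the argument
`2^j (y + l) - k` has modulus at least `2^j (|y + l| - 1)`, which leaves the support for large `|l|`
uniformly in `j`. Measurability and the uniform size bound both rest on this. -/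
lemma exists_finset_wavelet_eq_sum {φ ψ : ℝ → ℝ} (hφ : HasCompactSupport φ)
    (hψ : HasCompactSupport ψ) :
    ∃ K : Finset ℤ, ∀ a, IsIndex a → ∀ y ∈ Set.Icc (0 : ℝ) 1,
      wavelet φ ψ a y = ∑ l ∈ K, waveletTerm φ ψ a l y := by
  obtain ⟨R₁, hR₁, h₁⟩ := exists_support_bound hφ
  obtain ⟨R₂, hR₂, h₂⟩ := exists_support_bound hψ
  obtain ⟨N, hN⟩ := exists_nat_gt (max R₁ R₂ + 2)
  have hlarge : ∀ l : ℤ, l ∉ Finset.Icc (-(N : ℤ)) N → (N : ℝ) < |(l : ℝ)| := by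
    intro l hl
    rw [Finset.mem_Icc, ← abs_le, not_le] at hl
    exact_mod_cast hl
  have b1 := le_max_left R₁ R₂
  have b2 := le_max_right R₁ R₂
  refine ⟨Finset.Icc (-(N : ℤ)) N, fun a ha y hy => ?_⟩
  have hy1 : |y| ≤ 1 := abs_le.2 ⟨by linarith [hy.1], hy.2⟩
  cases a with
  | none =>
    refine tsum_eq_sum fun l hl => h₁ _ ?_
    have h3 : |(l : ℝ)| ≤ |y + l| + |y| := by
      simpa using abs_sub (y + l) y
    linarith [hlarge l hl]
  | some p =>
    refine tsum_eq_sum fun l hl => ?_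
    rw [h₂, mul_zero]
    have hp : (p.2 : ℝ) < 2 ^ p.1 := by exact_mod_cast ha
    have h2 : (1 : ℝ) ≤ 2 ^ p.1 := one_le_pow₀ (by norm_num)
    have h3 : |(l : ℝ)| ≤ |y + l| + |y| := by
      simpa using abs_sub (y + l) y
    have h4 : (2 : ℝ) ^ p.1 * |y + l| ≤ |(2 : ℝ) ^ p.1 * (y + l) - p.2| + p.2 := by
      have := abs_add_le ((2 : ℝ) ^ p.1 * (y + l) - p.2) p.2
      rwa [sub_add_cancel, abs_mul, abs_of_pos (by positivity : (0 : ℝ) < 2 ^ p.1),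
        Nat.abs_cast] at this
    have h5 : R₂ + 1 ≤ |y + l| := by linarith [hlarge l hl]
    nlinarith

/-- The periodised wavelets of level `j` are bounded on `[0,1]` by a multiple of `2 ^ (j / 2)`. -/
lemma IsWaveletBasis.exists_bound {φ ψ : ℝ → ℝ} (h : IsWaveletBasis φ ψ) :
    ∃ B : ℝ, 1 ≤ B ∧ ∀ a, IsIndex a → ∀ y ∈ Set.Icc (0 : ℝ) 1,
      |wavelet φ ψ a y| ≤ B * (2 : ℝ) ^ ((level a : ℝ) / 2) := by
  obtain ⟨K, hK⟩ := exists_finset_wavelet_eq_sum h.compact_scaling h.compact_mother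
  obtain ⟨B₁, hB₁⟩ := h.bounded_scaling
  obtain ⟨B₂, hB₂⟩ := h.bounded_mother
  have hB : 0 ≤ max B₁ B₂ := ((abs_nonneg _).trans (hB₁ 0)).trans (le_max_left _ _)
  refine ⟨K.card * max B₁ B₂ + 1, by nlinarith [(Nat.cast_nonneg K.card : (0 : ℝ) ≤ _)],
    fun a ha y hy => ?_⟩
  have hterm : ∀ l, |waveletTerm φ ψ a l y| ≤ max B₁ B₂ * (2 : ℝ) ^ ((level a : ℝ) / 2) := by
    intro l
    cases a with
    | none => simpa [waveletTerm, level] using Or.inl (hB₁ (y + l))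
    | some p =>
      simp only [waveletTerm, level, abs_mul]
      rw [abs_of_pos (by positivity : (0 : ℝ) < (2 : ℝ) ^ ((p.1 : ℝ) / 2)), mul_comm]
      exact mul_le_mul_of_nonneg_right ((hB₂ _).trans (le_max_right _ _)) (by positivity)
  rw [hK a ha y hy]
  refine (Finset.abs_sum_le_sum_abs _ _).trans ((Finset.sum_le_sum fun l _ => hterm l).trans ?_)
  rw [Finset.sum_const, nsmul_eq_mul, ← mul_assoc]
  exact mul_le_mul_of_nonneg_right (by linarith) (by positivity)

section Warped

variable {φ ψ : ℝ → ℝ}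

lemma cdf_mem_Icc (μ : Measure ℝ) (x : ℝ) : cdf μ x ∈ Set.Icc (0 : ℝ) 1 :=
  ⟨cdf_nonneg μ x, cdf_le_one μ x⟩

lemma measurable_warped (h : IsWaveletBasis φ ψ) (μ : Measure ℝ) {a : Option (ℕ × ℕ)}
    (ha : IsIndex a) :
    Measurable (warped φ ψ μ a) := by
  obtain ⟨K, hK⟩ := exists_finset_wavelet_eq_sum h.compact_scaling h.compact_mother
  have : warped φ ψ μ a = fun x => ∑ l ∈ K, waveletTerm φ ψ a l (cdf μ x) :=
    funext fun x => hK a ha _ (cdf_mem_Icc μ x)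
  rw [this]
  exact Finset.measurable_fun_sum _ fun l _ =>
    (measurable_waveletTerm h.measurable_scaling h.measurable_mother a l).comp
      (cdf μ).mono.measurable

lemma aestronglyMeasurable_wavelet (h : IsWaveletBasis φ ψ) {a : Option (ℕ × ℕ)} (ha : IsIndex a) :
    AEStronglyMeasurable (wavelet φ ψ a) (volume.restrict (Set.Icc (0 : ℝ) 1)) := by
  obtain ⟨K, hK⟩ := exists_finset_wavelet_eq_sum h.compact_scaling h.compact_mother
  have hm : Measurable fun y => ∑ l ∈ K, waveletTerm φ ψ a l y :=
    Finset.measurable_fun_sum _ fun l _ =>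
      measurable_waveletTerm h.measurable_scaling h.measurable_mother a l
  refine hm.aestronglyMeasurable.congr ?_
  filter_upwards [ae_restrict_mem measurableSet_Icc] with y hy using (hK a ha y hy).symm

lemma integral_warped_mul (h : IsWaveletBasis φ ψ) (μ : Measure ℝ)
    [IsProbabilityMeasure μ] [NullSingletonClass μ]
    {a b : Option (ℕ × ℕ)} (ha : IsIndex a) (hb : IsIndex b) :
    ∫ x, warped φ ψ μ a x * warped φ ψ μ b x ∂μ = if a = b then 1 else 0 := by
  rw [← h.orthonormal a b ha hb, ← map_cdf μ, integral_map]
  · rfl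
  · exact (continuous_cdf μ).measurable.aemeasurable
  · rw [map_cdf μ]
    exact (aestronglyMeasurable_wavelet h ha).mul (aestronglyMeasurable_wavelet h hb)

lemma memLp_warped (h : IsWaveletBasis φ ψ) (μ : Measure ℝ) [IsProbabilityMeasure μ]
    {a : Option (ℕ × ℕ)} (ha : IsIndex a) (p : ℝ≥0∞) :
    MemLp (warped φ ψ μ a) p μ := by
  obtain ⟨B, -, hB⟩ := h.exists_bound
  exact MemLp.of_bound (measurable_warped h μ ha).aestronglyMeasurable _
    (Filter.Eventually.of_forall fun x => hB a ha _ (cdf_mem_Icc μ x))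

/-- Parseval's identity for finite warped expansions. -/
lemma eLpNorm_sum_warped (h : IsWaveletBasis φ ψ) (μ : Measure ℝ)
    [IsProbabilityMeasure μ] [NullSingletonClass μ]
    (S : Finset (Option (ℕ × ℕ))) (hS : ∀ a ∈ S, IsIndex a) (c : Option (ℕ × ℕ) → ℝ) :
    eLpNorm (fun x => ∑ a ∈ S, c a * warped φ ψ μ a x) 2 μ
      = ENNReal.ofReal (Real.sqrt (∑ a ∈ S, c a ^ 2)) := by
  have hmem : MemLp (fun x => ∑ a ∈ S, c a * warped φ ψ μ a x) 2 μ :=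
    memLp_finsetSum _ fun a ha => (memLp_warped h μ (hS a ha) 2).const_mul _
  rw [hmem.eLpNorm_eq_integral_rpow_norm (by norm_num) (by norm_num)]
  have hint : ∀ a ∈ S, ∀ b ∈ S,
      Integrable (fun x => c a * warped φ ψ μ a x * (c b * warped φ ψ μ b x)) μ :=
    fun a ha b hb => ((memLp_warped h μ (hS a ha) 2).const_mul (c a)).integrable_mul
      ((memLp_warped h μ (hS b hb) 2).const_mul (c b))
  have key : ∫ x, ‖∑ a ∈ S, c a * warped φ ψ μ a x‖ ^ (2 : ℝ≥0∞).toReal ∂μ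
      = ∑ a ∈ S, c a ^ 2 := by
    have : ∀ x, ‖∑ a ∈ S, c a * warped φ ψ μ a x‖ ^ (2 : ℝ≥0∞).toReal
        = ∑ a ∈ S, ∑ b ∈ S, c a * warped φ ψ μ a x * (c b * warped φ ψ μ b x) := by
      intro x
      rw [← Finset.sum_mul_sum]
      simp [sq]
    simp_rw [this]
    rw [integral_finsetSum _ fun a ha => integrable_finsetSum _ fun b hb => hint a ha b hb]
    refine Finset.sum_congr rfl fun a ha => ?_
    rw [integral_finsetSum _ fun b hb => hint a ha b hb]
    rw [Finset.sum_eq_single_of_mem a ha]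
    · have := integral_warped_mul h μ (hS a ha) (hS a ha)
      simp only [if_true] at this
      calc ∫ x, c a * warped φ ψ μ a x * (c a * warped φ ψ μ a x) ∂μ
          = ∫ x, c a ^ 2 * (warped φ ψ μ a x * warped φ ψ μ a x) ∂μ := by
            congr 1; ext x; ring
        _ = c a ^ 2 := by rw [integral_const_mul, this, mul_one]
    · intro b hb hne
      have := integral_warped_mul h μ (hS a ha) (hS b hb)
      rw [if_neg (Ne.symm hne)] at this
      calc ∫ x, c a * warped φ ψ μ a x * (c b * warped φ ψ μ b x) ∂μ
          = ∫ x, c a * c b * (warped φ ψ μ a x * warped φ ψ μ b x) ∂μ := by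
            congr 1; ext x; ring
        _ = 0 := by rw [integral_const_mul, this, mul_zero]
  rw [key, Real.sqrt_eq_rpow]
  norm_num

end Warped

/-! ### Bernstein's inequality -/

/-- From `e^x ≤ 1 + x + x²` for `|x| ≤ 1`, then `1 + u ≤ e^u`. The second moment replaces the
variance, so no centring is needed. -/
lemma integral_exp_le {Ω : Type*} [MeasurableSpace Ω] {P : Measure Ω} [IsProbabilityMeasure P]
    {g : Ω → ℝ} (hg : AEMeasurable g P) {b v t : ℝ} (hb : ∀ᵐ ω ∂P, |g ω| ≤ b)
    (hv : ∫ ω, g ω ^ 2 ∂P ≤ v) (ht : |t| * b ≤ 1) :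
    mgf g P t ≤ Real.exp (t * ∫ ω, g ω ∂P + t ^ 2 * v) := by
  have hgi : Integrable g P := Integrable.of_bound hg.aestronglyMeasurable b hb
  have hg2 : Integrable (fun ω => g ω ^ 2) P :=
    Integrable.of_bound (hg.pow_const 2).aestronglyMeasurable (b ^ 2) (by
      filter_upwards [hb] with ω hω
      rw [Real.norm_eq_abs, abs_pow]
      exact pow_le_pow_left₀ (abs_nonneg _) hω 2)
  have hpt : ∀ᵐ ω ∂P, Real.exp (t * g ω) ≤ 1 + t * g ω + t ^ 2 * g ω ^ 2 := by
    filter_upwards [hb] with ω hω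
    have h1 : |t * g ω| ≤ 1 := by
      rw [abs_mul]; exact (mul_le_mul_of_nonneg_left hω (abs_nonneg t)).trans ht
    have := (abs_le.1 (Real.abs_exp_sub_one_sub_id_le h1)).2
    nlinarith
  have hi1 : Integrable (fun ω => 1 + t * g ω) P := (integrable_const _).add (hgi.const_mul t)
  calc mgf g P t ≤ ∫ ω, 1 + t * g ω + t ^ 2 * g ω ^ 2 ∂P :=
        integral_mono_of_nonneg (Filter.Eventually.of_forall fun _ => (Real.exp_pos _).le)
          (hi1.add (hg2.const_mul _)) hpt
    _ = 1 + t * ∫ ω, g ω ∂P + t ^ 2 * ∫ ω, g ω ^ 2 ∂P := by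
        rw [integral_add hi1 (hg2.const_mul _), integral_add (integrable_const _)
          (hgi.const_mul t), integral_const_mul, integral_const_mul]
        simp
    _ ≤ (t * ∫ ω, g ω ∂P + t ^ 2 * v) + 1 := by nlinarith [sq_nonneg t]
    _ ≤ _ := Real.add_one_le_exp _

/-- One-sided Bernstein inequality for an empirical mean, with the exponent `t` left free. -/
lemma measure_empirical_mean_ge_le {Ω : Type*} [MeasurableSpace Ω] {P : Measure Ω}
    [IsProbabilityMeasure P] {g : Ω → ℝ} (hg : AEMeasurable g P) {b v t u : ℝ}
    (hb : ∀ᵐ ω ∂P, |g ω| ≤ b) (hv : ∫ ω, g ω ^ 2 ∂P ≤ v) (ht0 : 0 ≤ t) (ht : t * b ≤ 1)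
    {n : ℕ} (hn : 0 < n) :
    (Measure.pi fun _ : Fin n => P)
        {z | u ≤ (n : ℝ)⁻¹ * ∑ i, g (z i) - ∫ ω, g ω ∂P}
      ≤ ENNReal.ofReal (Real.exp (-(n * (t * u - t ^ 2 * v)))) := by
  set Q := Measure.pi fun _ : Fin n => P with hQ
  set m := ∫ ω, g ω ∂P with hm
  have hn' : (0 : ℝ) < n := by exact_mod_cast hn
  have hmeas : ∀ i : Fin n, AEMeasurable (fun z : Fin n → Ω => g (z i)) Q := fun i =>
    hg.comp_quasiMeasurePreserving (Measure.quasiMeasurePreserving_eval _ i)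
  have hind : iIndepFun (fun (i : Fin n) (z : Fin n → Ω) => g (z i)) Q :=
    iIndepFun_pi (μ := fun _ : Fin n => P) (X := fun _ => g) fun _ => hg
  have hmgf : ∀ i : Fin n, mgf (fun z : Fin n → Ω => g (z i)) Q t = mgf g P t := fun i => by
    have hmp : MeasurePreserving (Function.eval i) Q P := measurePreserving_eval (fun _ => P) i
    have := mgf_map (Y := Function.eval i) (X := g) (μ := Q) (t := t) hmp.measurable.aemeasurable
      (by rw [hmp.map_eq]; exact (hg.const_mul t).exp.aestronglyMeasurable)
    rw [hmp.map_eq] at this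
    exact this.symm
  have hsum : mgf (∑ i : Fin n, fun z : Fin n → Ω => g (z i)) Q t = mgf g P t ^ n := by
    rw [hind.mgf_sum₀ hmeas]
    simp [hmgf]
  have hbd : ∀ᵐ z ∂Q, ∀ i, |g (z i)| ≤ b := by
    rw [ae_all_iff]
    exact fun i => (Measure.quasiMeasurePreserving_eval (fun _ => P) i).ae hb
  have hint : Integrable
      (fun z => Real.exp (t * (∑ i : Fin n, fun z : Fin n → Ω => g (z i)) z)) Q := by
    refine Integrable.of_bound ((Finset.aemeasurable_sum _ fun i _ => hmeas i).const_mul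
      t).exp.aestronglyMeasurable (Real.exp (t * (n * b))) ?_
    filter_upwards [hbd] with z hz
    rw [Real.norm_eq_abs, Real.abs_exp, Real.exp_le_exp]
    refine mul_le_mul_of_nonneg_left ?_ ht0
    rw [Finset.sum_apply]
    refine (Finset.sum_le_sum fun i _ => (le_abs_self _).trans (hz i)).trans ?_
    simp
  have hch := measure_ge_le_exp_mul_mgf (μ := Q) (n * (u + m)) ht0 hint
  have hset : {z : Fin n → Ω | u ≤ (n : ℝ)⁻¹ * ∑ i, g (z i) - m}
      = {z | n * (u + m) ≤ (∑ i : Fin n, fun z : Fin n → Ω => g (z i)) z} := by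
    ext z
    simp only [Set.mem_ofPred_eq, Finset.sum_apply]
    rw [le_sub_iff_add_le, inv_mul_eq_div, le_div_iff₀ hn', mul_comm]
  rw [hset, ← ofReal_measureReal]
  refine ENNReal.ofReal_le_ofReal (hch.trans ?_)
  rw [hsum]
  have h1 := integral_exp_le hg hb hv (t := t) (by rwa [abs_of_nonneg ht0])
  calc Real.exp (-t * (n * (u + m))) * mgf g P t ^ n
      ≤ Real.exp (-t * (n * (u + m))) * Real.exp (t * m + t ^ 2 * v) ^ n :=
        mul_le_mul_of_nonneg_left (pow_le_pow_left₀ mgf_nonneg h1 n) (Real.exp_pos _).le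
    _ = _ := by
        rw [← Real.exp_nat_mul, ← Real.exp_add]
        congr 1; ring

lemma measure_abs_empirical_mean_ge_le {Ω : Type*} [MeasurableSpace Ω] {P : Measure Ω}
    [IsProbabilityMeasure P] {g : Ω → ℝ} (hg : AEMeasurable g P) {b v t u : ℝ}
    (hb : ∀ᵐ ω ∂P, |g ω| ≤ b) (hv : ∫ ω, g ω ^ 2 ∂P ≤ v) (ht0 : 0 ≤ t) (ht : t * b ≤ 1)
    {n : ℕ} (hn : 0 < n) :
    (Measure.pi fun _ : Fin n => P)
        {z | u ≤ |(n : ℝ)⁻¹ * ∑ i, g (z i) - ∫ ω, g ω ∂P|}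
      ≤ 2 * ENNReal.ofReal (Real.exp (-(n * (t * u - t ^ 2 * v)))) := by
  have h1 := measure_empirical_mean_ge_le (u := u) hg hb hv ht0 ht hn
  have h2 := measure_empirical_mean_ge_le (g := fun ω => -g ω) (u := u) (v := v) hg.neg
    (by simpa using hb) (by simpa using hv) ht0 ht hn
  rw [two_mul]
  refine (measure_mono fun z hz => ?_).trans ((measure_union_le _ _).trans (add_le_add h1 h2))
  simp only [Set.mem_ofPred_eq, le_abs] at hz
  rcases hz with hz | hz
  · exact Or.inl hz
  · right
    simp only [Set.mem_ofPred_eq, Finset.sum_neg_distrib, integral_neg]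
    linarith

/-! ### Trees -/

lemma mem_levelTree {J : ℕ} {p : ℕ × ℕ} : p ∈ levelTree J ↔ p.1 < J ∧ p.2 < 2 ^ p.1 := by
  simp only [levelTree, Finset.mem_filter, Finset.mem_product, Finset.mem_range]
  refine ⟨fun h => ⟨h.1.1, h.2⟩, fun h => ⟨⟨h.1, h.2.trans_le ?_⟩, h.2⟩⟩
  exact Nat.pow_le_pow_right (by norm_num) h.1.le

lemma mem_children {p q : ℕ × ℕ} : q ∈ children p ↔ q.1 = p.1 + 1 ∧ q.2 / 2 = p.2 := by
  simp only [children, Finset.mem_insert, Finset.mem_singleton, Prod.ext_iff]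
  omega

lemma sum_children (p : ℕ × ℕ) (g : ℕ × ℕ → ℝ) :
    ∑ q ∈ children p, g q = g (p.1 + 1, 2 * p.2) + g (p.1 + 1, 2 * p.2 + 1) :=
  Finset.sum_pair (by simp)

lemma isBelow_refl (p : ℕ × ℕ) : IsBelow p p := by simp [IsBelow]

lemma children_mem_levelTree {J : ℕ} {p q : ℕ × ℕ} (hp : p ∈ levelTree J) (hq : q ∈ children p) :
    q ∈ levelTree (J + 1) := by
  rw [mem_levelTree] at hp ⊢
  obtain ⟨h1, h2⟩ := mem_children.1 hq
  rw [h1, pow_succ]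
  omega

lemma exists_parent {J : ℕ} {q : ℕ × ℕ} (hq : q ∈ levelTree (J + 1)) (h0 : q ≠ (0, 0)) :
    ∃ p ∈ levelTree J, q ∈ children p := by
  rw [mem_levelTree] at hq
  obtain ⟨j, k⟩ := q
  cases j with
  | zero => simp_all
  | succ j =>
    simp only [pow_succ] at hq
    refine ⟨(j, k / 2), mem_levelTree.2 ⟨by simp only; omega, by simp only; omega⟩,
      mem_children.2 ⟨rfl, rfl⟩⟩

lemma union_outerLeaves (T : Finset (ℕ × ℕ)) :
    T ∪ outerLeaves T = T ∪ insert (0, 0) (T.biUnion children) :=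
  Finset.union_sdiff_self_eq_union

lemma union_outerLeaves_subset {J : ℕ} {T : Finset (ℕ × ℕ)} (hT : T ⊆ levelTree J) :
    T ∪ outerLeaves T ⊆ levelTree (J + 1) := by
  rw [union_outerLeaves]
  intro q hq
  simp only [Finset.mem_union, Finset.mem_insert, Finset.mem_biUnion] at hq
  rcases hq with hq | rfl | ⟨p, hp, hq⟩
  · have := mem_levelTree.1 (hT hq)
    exact mem_levelTree.2 ⟨by omega, this.2⟩
  · simp [mem_levelTree]
  · exact children_mem_levelTree (hT hp) hq

/-- The outer leaves supply level `J`, including the root when `J = 0`. Hence all coefficients in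
play have level at most `J`, not below `J`. -/
lemma levelTree_union_outerLeaves (J : ℕ) :
    levelTree J ∪ outerLeaves (levelTree J) = levelTree (J + 1) := by
  refine (union_outerLeaves_subset subset_rfl).antisymm fun q hq => ?_
  rw [union_outerLeaves]
  simp only [Finset.mem_union, Finset.mem_insert, Finset.mem_biUnion]
  by_cases h0 : q = (0, 0)
  · exact Or.inr (Or.inl h0)
  · exact Or.inr (Or.inr (exists_parent hq h0))

/-- The number of estimated coefficients is comparable to the size of the tree, so a cardinality
bound controls the stochastic error. -/
lemma card_union_outerLeaves_le (T : Finset (ℕ × ℕ)) :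
    (T ∪ outerLeaves T).card ≤ 3 * T.card + 1 := by
  rw [union_outerLeaves]
  have h1 : (T.biUnion children).card ≤ T.card * 2 :=
    Finset.card_biUnion_le_card_mul _ _ _ fun p _ => Finset.card_le_two
  have h2 := Finset.card_union_le T (insert (0, 0) (T.biUnion children))
  have h3 := Finset.card_insert_le (0, 0) (T.biUnion children)
  omega

lemma card_levelTree_le (J : ℕ) : (levelTree J).card ≤ 4 ^ J := by
  refine (Finset.card_filter_le _ _).trans ?_
  rw [Finset.card_product, Finset.card_range, Finset.card_range,
    show (4 : ℕ) = 2 * 2 by norm_num, mul_pow]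
  exact Nat.mul_le_mul_right _ Nat.lt_two_pow_self.le

/-! ### Decomposition of the error -/

lemma isIndex_of_mem {J : ℕ} {a : Option (ℕ × ℕ)} (ha : a ∈ (levelTree J).insertNone) :
    IsIndex a := by
  cases a with
  | none => trivial
  | some p => exact (mem_levelTree.1 (Finset.some_mem_insertNone.1 ha)).2

lemma level_le_of_mem {J : ℕ} {a : Option (ℕ × ℕ)} (ha : a ∈ (levelTree (J + 1)).insertNone) :
    level a ≤ J := by
  cases a with
  | none => exact Nat.zero_le _
  | some p => exact Nat.lt_succ_iff.1 (mem_levelTree.1 (Finset.some_mem_insertNone.1 ha)).1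

lemma treeSum_eq (φ ψ : ℝ → ℝ) (μ : Measure ℝ) (d : Option (ℕ × ℕ) → ℝ) (T : Finset (ℕ × ℕ))
    (x : ℝ) : treeSum φ ψ μ d T x
      = ∑ a ∈ (T ∪ outerLeaves T).insertNone, d a * warped φ ψ μ a x := by
  rw [treeSum, Finset.sum_insertNone]

lemma residual_sq (d : Option (ℕ × ℕ) → ℝ) (p : ℕ × ℕ) :
    residual d p ^ 2 = ∑ q ∈ children p, d (some q) ^ 2 :=
  Real.sq_sqrt (Finset.sum_nonneg fun _ _ => sq_nonneg _)

lemma residual_nonneg (d : Option (ℕ × ℕ) → ℝ) (p : ℕ × ℕ) : 0 ≤ residual d p :=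
  Real.sqrt_nonneg _

/-- A missing node is not the root and its parent is outside `T`, so its energy is counted in the
residual of that parent. Distinct parents have disjoint children. -/
lemma sum_sq_sdiff_le_sum_residual {J : ℕ} (T : Finset (ℕ × ℕ)) (d : Option (ℕ × ℕ) → ℝ) :
    ∑ q ∈ levelTree (J + 1) \ (T ∪ outerLeaves T), d (some q) ^ 2
      ≤ ∑ p ∈ levelTree J \ T, residual d p ^ 2 := by
  simp_rw [residual_sq]
  rw [← Finset.sum_biUnion]
  · refine Finset.sum_le_sum_of_subset_of_nonneg (fun q hq => ?_) fun _ _ _ => sq_nonneg _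
    rw [union_outerLeaves] at hq
    simp only [Finset.mem_sdiff, Finset.mem_union, Finset.mem_insert, Finset.mem_biUnion,
      not_or, not_exists, not_and] at hq ⊢
    obtain ⟨p, hp, hqp⟩ := exists_parent hq.1 hq.2.2.1
    exact ⟨p, ⟨hp, fun hpT => hq.2.2.2 p hpT hqp⟩, hqp⟩
  · intro p _ p' _ hne
    refine Finset.disjoint_left.2 fun q hq hq' => hne ?_
    rw [mem_children] at hq hq'
    exact Prod.ext (by omega) (by omega)

/-- The error of a tree-structured estimate: bias of the uniform partition, bias of the tree,
and stochastic error. -/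
lemma eLpNorm_sub_treeSum_le {φ ψ : ℝ → ℝ} (h : IsWaveletBasis φ ψ) (μ : Measure ℝ)
    [IsProbabilityMeasure μ] [NullSingletonClass μ] {f : ℝ → ℝ} (hf : Measurable f) {J : ℕ}
    {T : Finset (ℕ × ℕ)} (hT : T ⊆ levelTree J) (d d' : Option (ℕ × ℕ) → ℝ) :
    eLpNorm (fun x => f x - treeSum φ ψ μ d' T x) 2 μ
      ≤ eLpNorm (fun x => f x - treeSum φ ψ μ d (levelTree J) x) 2 μ
        + ENNReal.ofReal (Real.sqrt (∑ p ∈ levelTree J \ T, residual d p ^ 2))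
        + ENNReal.ofReal (Real.sqrt
            (∑ a ∈ (T ∪ outerLeaves T).insertNone, (d' a - d a) ^ 2)) := by
  have hsub := union_outerLeaves_subset hT
  set U := T ∪ outerLeaves T with hU
  -- `V` indexes the terms of the uniform expansion that the tree expansion drops.
  set V := (levelTree (J + 1) \ U).map Function.Embedding.some with hV
  have hVI : ∀ a ∈ V, IsIndex a := by
    intro a ha
    obtain ⟨q, hq, rfl⟩ := Finset.mem_map.1 ha
    exact (mem_levelTree.1 (Finset.mem_sdiff.1 hq).1).2
  have hUI : ∀ a ∈ U.insertNone, IsIndex a := fun a ha =>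
    isIndex_of_mem (Finset.insertNone.monotone hsub ha)
  have hLI : ∀ a ∈ (levelTree (J + 1)).insertNone, IsIndex a := fun a ha => isIndex_of_mem ha
  have hmeas : ∀ (S : Finset (Option (ℕ × ℕ))), (∀ a ∈ S, IsIndex a) →
      ∀ c : Option (ℕ × ℕ) → ℝ, Measurable fun x => ∑ a ∈ S, c a * warped φ ψ μ a x :=
    fun S hS c => Finset.measurable_fun_sum _ fun a ha =>
      (measurable_warped h μ (hS a ha)).const_mul _
  have hsplit : (fun x => f x - treeSum φ ψ μ d' T x)
      = (fun x => f x - treeSum φ ψ μ d (levelTree J) x)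
        + (fun x => ∑ a ∈ V, d a * warped φ ψ μ a x)
        - (fun x => ∑ a ∈ U.insertNone, (d' a - d a) * warped φ ψ μ a x) := by
    funext x
    simp only [Pi.add_apply, Pi.sub_apply, treeSum_eq, levelTree_union_outerLeaves, sub_mul,
      Finset.sum_sub_distrib, hV, Finset.sum_map, Finset.sum_insertNone,
      Function.Embedding.some_apply, ← hU]
    have := Finset.sum_sdiff (f := fun q => d (some q) * warped φ ψ μ (some q) x) hsub
    linarith
  have hm1 : Measurable fun x => f x - treeSum φ ψ μ d (levelTree J) x := by
    simp_rw [treeSum_eq, levelTree_union_outerLeaves]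
    exact hf.sub (hmeas _ hLI d)
  rw [hsplit]
  refine (eLpNorm_sub_le (hm1.add (hmeas V hVI d)).aestronglyMeasurable
    (hmeas _ hUI _).aestronglyMeasurable (by norm_num)).trans ?_
  refine add_le_add ((eLpNorm_add_le hm1.aestronglyMeasurable
    (hmeas V hVI d).aestronglyMeasurable (by norm_num)).trans (add_le_add le_rfl ?_)) ?_
  · rw [eLpNorm_sum_warped h μ V hVI]
    refine ENNReal.ofReal_le_ofReal (Real.sqrt_le_sqrt ?_)
    rw [hV, Finset.sum_map]
    exact sum_sq_sdiff_le_sum_residual T d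
  · exact (eLpNorm_sum_warped h μ _ hUI _).le

/-! ### Summing small residuals -/

/-- If the number of values at least `t` is at most `C t ^ (-q)` with `q < 2`, the values below
`Λ` contribute at most a multiple of `Λ ^ (2 - q)` to the sum of squares. -/
lemma sum_sq_filter_lt_le {ι : Type*} (S : Finset ι) (ν : ι → ℝ) (hν : ∀ i ∈ S, 0 ≤ ν i)
    {q C : ℝ} (hq : q < 2) (hC : 0 ≤ C)
    (hcard : ∀ t : ℝ, 0 < t → t ^ q * ((S.filter fun i => t ≤ ν i).card : ℝ) ≤ C)
    {Λ : ℝ} (hΛ : 0 < Λ) :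
    ∑ i ∈ S.filter (fun i => ν i < Λ), ν i ^ 2
      ≤ C * 2 ^ q / (1 - 2⁻¹ ^ (2 - q)) * Λ ^ (2 - q) := by
  set A := C * 2 ^ q / (1 - (2⁻¹ : ℝ) ^ (2 - q)) with hA
  have hden : 0 < 1 - (2⁻¹ : ℝ) ^ (2 - q) := by
    have := Real.rpow_lt_one (x := (2⁻¹ : ℝ)) (by norm_num) (by norm_num)
      (by linarith : 0 < 2 - q)
    linarith
  have hA0 : 0 ≤ A := by positivity
  -- Peel off `N` dyadic slices below `Λ`. The constant `A` sums the geometric series, that is, `A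
  -- 2^(-(2-q)) + C 2^q = A`; the values below `Λ 2^(-N)` are bounded crudely and vanish as `N → ∞`.
  have step : ∀ N : ℕ, ∀ Λ : ℝ, 0 < Λ → ∑ i ∈ S.filter (fun i => ν i < Λ), ν i ^ 2
      ≤ A * Λ ^ (2 - q) + S.card * (Λ * 2⁻¹ ^ N) ^ 2 := by
    intro N
    induction N with
    | zero =>
      intro Λ hΛ
      have : ∑ i ∈ S.filter (fun i => ν i < Λ), ν i ^ 2 ≤ S.card * Λ ^ 2 := by
        calc _ ≤ ∑ i ∈ S.filter (fun i => ν i < Λ), Λ ^ 2 := by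
              refine Finset.sum_le_sum fun i hi => ?_
              rw [Finset.mem_filter] at hi
              exact pow_le_pow_left₀ (hν i hi.1) hi.2.le 2
          _ = (S.filter (fun i => ν i < Λ)).card * Λ ^ 2 := by simp
          _ ≤ _ := by
              gcongr
              exact Finset.filter_subset _ _
      have h2 : 0 ≤ A * Λ ^ (2 - q) := by positivity
      simpa using this.trans (le_add_of_nonneg_left h2)
    | succ N ih =>
      intro Λ hΛ
      have hhalf := ih (Λ * 2⁻¹) (by positivity)
      have hsplit := Finset.sum_filter_add_sum_filter_not (S.filter fun i => ν i < Λ)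
        (fun i => ν i < Λ * 2⁻¹) fun i => ν i ^ 2
      rw [Finset.filter_filter, Finset.filter_filter,
        Finset.filter_congr (q := fun i => ν i < Λ * 2⁻¹)
          fun i _ => ⟨And.right, fun hi => ⟨by linarith, hi⟩⟩,
        Finset.filter_congr (p := fun i => ν i < Λ ∧ ¬ν i < Λ * 2⁻¹)
          (q := fun i => Λ * 2⁻¹ ≤ ν i ∧ ν i < Λ) fun i _ => by rw [not_lt, and_comm],
        ← Finset.filter_filter] at hsplit
      have htop : ∑ i ∈ (S.filter fun i => Λ * 2⁻¹ ≤ ν i).filter (fun i => ν i < Λ), ν i ^ 2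
          ≤ C * 2 ^ q * Λ ^ (2 - q) := by
        have hc := hcard (Λ * 2⁻¹) (by positivity)
        calc _ ≤ ∑ i ∈ (S.filter fun i => Λ * 2⁻¹ ≤ ν i).filter (fun i => ν i < Λ), Λ ^ 2 := by
              refine Finset.sum_le_sum fun i hi => ?_
              simp only [Finset.mem_filter] at hi
              exact pow_le_pow_left₀ (hν i hi.1.1) hi.2.le 2
          _ = ((S.filter fun i => Λ * 2⁻¹ ≤ ν i).filter (fun i => ν i < Λ)).card * Λ ^ 2 := by
              simp
          _ ≤ (S.filter fun i => Λ * 2⁻¹ ≤ ν i).card * Λ ^ 2 := by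
              gcongr
              exact Finset.filter_subset _ _
          _ ≤ (C * ((Λ * 2⁻¹) ^ q)⁻¹) * Λ ^ 2 := by
              refine mul_le_mul_of_nonneg_right ?_ (sq_nonneg Λ)
              rw [le_mul_inv_iff₀ (by positivity), mul_comm]
              exact hc
          _ = C * 2 ^ q * Λ ^ (2 - q) := by
              rw [Real.mul_rpow hΛ.le (by norm_num), Real.inv_rpow (by norm_num),
                Real.rpow_sub hΛ, mul_inv, inv_inv]
              norm_num
              ring
      have hrec : A * (Λ * 2⁻¹) ^ (2 - q) + C * 2 ^ q * Λ ^ (2 - q) = A * Λ ^ (2 - q) := by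
        rw [Real.mul_rpow hΛ.le (by norm_num)]
        have : A * (1 - (2⁻¹ : ℝ) ^ (2 - q)) = C * 2 ^ q := div_mul_cancel₀ _ hden.ne'
        rw [← this]; ring
      have hN : (S.card : ℝ) * (Λ * 2⁻¹ * 2⁻¹ ^ N) ^ 2 = S.card * (Λ * 2⁻¹ ^ (N + 1)) ^ 2 := by
        ring
      linarith
  refine ge_of_tendsto' (f := fun N : ℕ => A * Λ ^ (2 - q) + S.card * (Λ * 2⁻¹ ^ N) ^ 2)
    (x := Filter.atTop) ?_ fun N => step N Λ hΛ
  have h0 : Filter.Tendsto (fun N : ℕ => (2⁻¹ : ℝ) ^ N) Filter.atTop (nhds 0) :=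
    tendsto_pow_atTop_nhds_zero_of_lt_one (by norm_num) (by norm_num)
  simpa using ((((h0.const_mul Λ).pow 2).const_mul (S.card : ℝ)).const_add (A * Λ ^ (2 - q)))

/-! ### The empirical tree when all coefficients are well estimated -/

/-- The triangle inequality in `ℓ²` of the two children would give `√2 λ/4`, which is below `λ/2`.
-/
lemma residual_le_add {d d' : Option (ℕ × ℕ) → ℝ} {lam : ℝ} {p : ℕ × ℕ} (hlam : 0 ≤ lam)
    (h : ∀ q ∈ children p, |d' (some q) - d (some q)| ≤ lam / 4) :
    residual d' p ≤ residual d p + lam / 2 := by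
  have hr := residual_nonneg d p
  have hsq := residual_sq d p
  rw [sum_children] at hsq
  refine Real.sqrt_le_iff.2 ⟨by positivity, ?_⟩
  rw [sum_children]
  have h1 := h (p.1 + 1, 2 * p.2) (by simp [children])
  have h2 := h (p.1 + 1, 2 * p.2 + 1) (by simp [children])
  generalize d' (some (p.1 + 1, 2 * p.2)) = a at *
  generalize d' (some (p.1 + 1, 2 * p.2 + 1)) = b at *
  generalize d (some (p.1 + 1, 2 * p.2)) = x at *
  generalize d (some (p.1 + 1, 2 * p.2 + 1)) = y at *
  have hx : |x| ≤ residual d p := abs_le_of_sq_le_sq (by nlinarith [sq_nonneg y]) hr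
  have hy : |y| ≤ residual d p := abs_le_of_sq_le_sq (by nlinarith [sq_nonneg x]) hr
  have key : ∀ a x : ℝ, |a - x| ≤ lam / 4 → |x| ≤ residual d p →
      a ^ 2 ≤ x ^ 2 + lam / 2 * residual d p + lam ^ 2 / 16 := by
    intro a x hax hx
    have e : a ^ 2 = x ^ 2 + 2 * (x * (a - x)) + (a - x) ^ 2 := by ring
    have e1 : x * (a - x) ≤ residual d p * (lam / 4) :=
      (le_abs_self _).trans (by rw [abs_mul]; gcongr)
    have e2 : (a - x) ^ 2 ≤ (lam / 4) ^ 2 := sq_le_sq.2 (by rwa [abs_of_nonneg (by positivity :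
      0 ≤ lam / 4)])
    nlinarith
  nlinarith [key a x h1 hx, key b y h2 hy]

lemma mem_empTree {φ ψ : ℝ → ℝ} {μ : Measure ℝ} {n : ℕ} {z : Fin n → ℝ × ℝ} {lam : ℝ} {J : ℕ}
    {p : ℕ × ℕ} : p ∈ empTree φ ψ μ z lam J ↔ p ∈ levelTree J ∧
      ∃ q ∈ levelTree J, IsBelow q p ∧ lam ≤ residual (empCoeff φ ψ μ z) q := by
  classical
  simp only [empTree, Finset.mem_filter]

lemma empTree_subset_levelTree (φ ψ : ℝ → ℝ) (μ : Measure ℝ) {n : ℕ} (z : Fin n → ℝ × ℝ)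
    (lam : ℝ) (J : ℕ) : empTree φ ψ μ z lam J ⊆ levelTree J :=
  fun _ hp => (mem_empTree.1 hp).1

section GoodEvent

variable {φ ψ : ℝ → ℝ} {μ : Measure ℝ} {f : ℝ → ℝ} {n : ℕ} {z : Fin n → ℝ × ℝ} {lam : ℝ} {J : ℕ}

lemma empTree_subset_residualTree (hlam : 0 ≤ lam)
    (hz : ∀ a ∈ (levelTree (J + 1)).insertNone,
      |empCoeff φ ψ μ z a - coeff φ ψ μ f a| ≤ lam / 4) :
    (empTree φ ψ μ z lam J : Set (ℕ × ℕ)) ⊆ residualTree φ ψ μ f (lam / 2) := by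
  intro p hp
  obtain ⟨-, q, hq, hqp, hle⟩ := mem_empTree.1 (Finset.mem_coe.1 hp)
  refine ⟨q, (mem_levelTree.1 hq).2, hqp, ?_⟩
  have := residual_le_add (d := coeff φ ψ μ f) (d' := empCoeff φ ψ μ z) (p := q) hlam
    fun r hr => hz _ (Finset.some_mem_insertNone.2 (children_mem_levelTree hq hr))
  linarith

lemma residual_lt_of_notMem_empTree (hlam : 0 < lam)
    (hz : ∀ a ∈ (levelTree (J + 1)).insertNone,
      |empCoeff φ ψ μ z a - coeff φ ψ μ f a| ≤ lam / 4)
    {p : ℕ × ℕ} (hp : p ∈ levelTree J \ empTree φ ψ μ z lam J) :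
    residual (coeff φ ψ μ f) p < 2 * lam := by
  obtain ⟨hpJ, hpT⟩ := Finset.mem_sdiff.1 hp
  have h1 : residual (empCoeff φ ψ μ z) p < lam := by
    by_contra hge
    exact hpT (mem_empTree.2 ⟨hpJ, p, hpJ, isBelow_refl p, not_lt.1 hge⟩)
  have := residual_le_add (d := empCoeff φ ψ μ z) (d' := coeff φ ψ μ f) (p := p) hlam.le
    fun r hr => by
      rw [abs_sub_comm]
      exact hz _ (Finset.some_mem_insertNone.2 (children_mem_levelTree hpJ hr))
  linarith

/-- The error of the thresholded estimate when all coefficients are estimated up to `lam / 4`. -/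
lemma eLpNorm_sub_treeSum_empTree_le (h : IsWaveletBasis φ ψ) [IsProbabilityMeasure μ]
    [NullSingletonClass μ] (hf : Measurable f) {s C : ℝ} (hs : 0 < s) (hC : 0 ≤ C)
    (hB : ∀ lam : ℝ, 0 < lam → (residualTree φ ψ μ f lam).Finite ∧
      lam ^ (s + 1 / 2)⁻¹ * ((residualTree φ ψ μ f lam).ncard : ℝ) ≤ C)
    (hlam : 0 < lam)
    (hz : ∀ a ∈ (levelTree (J + 1)).insertNone,
      |empCoeff φ ψ μ z a - coeff φ ψ μ f a| ≤ lam / 4) :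
    eLpNorm (fun x => f x - treeSum φ ψ μ (empCoeff φ ψ μ z) (empTree φ ψ μ z lam J) x) 2 μ
      ≤ eLpNorm (fun x => f x - treeSum φ ψ μ (coeff φ ψ μ f) (levelTree J) x) 2 μ
        + ENNReal.ofReal (Real.sqrt (C * 2 ^ (s + 1 / 2)⁻¹ / (1 - 2⁻¹ ^ (2 - (s + 1 / 2)⁻¹))
            * (2 * lam) ^ (2 - (s + 1 / 2)⁻¹)))
        + ENNReal.ofReal (Real.sqrt (lam ^ 2 + C * 2 ^ (s + 1 / 2)⁻¹
            * lam ^ (2 - (s + 1 / 2)⁻¹))) := by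
  set q := (s + 1 / 2)⁻¹ with hq
  have hq2 : q < 2 := by
    rw [hq, inv_lt_comm₀ (by positivity) (by norm_num)]; linarith
  refine (eLpNorm_sub_treeSum_le h μ hf (empTree_subset_levelTree φ ψ μ z lam J)
    (coeff φ ψ μ f) (empCoeff φ ψ μ z)).trans ?_
  set T := empTree φ ψ μ z lam J with hT
  refine add_le_add (add_le_add le_rfl (ENNReal.ofReal_le_ofReal (Real.sqrt_le_sqrt ?_)))
    (ENNReal.ofReal_le_ofReal (Real.sqrt_le_sqrt ?_))
  · have hfilter : (levelTree J \ T).filter (fun p => residual (coeff φ ψ μ f) p < 2 * lam)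
        = levelTree J \ T :=
      Finset.filter_true_of_mem fun p hp => residual_lt_of_notMem_empTree hlam hz hp
    have := sum_sq_filter_lt_le (levelTree J \ T) (residual (coeff φ ψ μ f))
      (fun p _ => residual_nonneg _ p) hq2 hC (fun t ht => ?_) (Λ := 2 * lam) (by positivity)
    · rwa [hfilter] at this
    · obtain ⟨hfin, hcard⟩ := hB t ht
      refine le_trans ?_ hcard
      gcongr
      rw [← Set.ncard_coe_finset]
      refine Set.ncard_le_ncard (fun p hp => ?_) hfin
      obtain ⟨h1, h2⟩ := Finset.mem_filter.1 (Finset.mem_coe.1 hp)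
      exact ⟨p, (mem_levelTree.1 (Finset.mem_sdiff.1 h1).1).2, isBelow_refl p, h2⟩
  · have hcardT : (T.card : ℝ) ≤ C * 2 ^ q * lam ^ (-q) := by
      obtain ⟨hfin, hcard⟩ := hB (lam / 2) (by positivity)
      have h1 : (T.card : ℝ) ≤ (residualTree φ ψ μ f (lam / 2)).ncard := by
        rw [← Set.ncard_coe_finset]
        exact_mod_cast Set.ncard_le_ncard (empTree_subset_residualTree hlam.le hz) hfin
      have h2 : (lam / 2) ^ q * (T.card : ℝ) ≤ C := le_trans (by gcongr) hcard
      rw [Real.rpow_neg hlam.le, ← div_eq_mul_inv, le_div_iff₀ (by positivity)]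
      rw [Real.div_rpow hlam.le (by norm_num), div_mul_eq_mul_div,
        div_le_iff₀ (by positivity)] at h2
      linarith
    have hcard : (((T ∪ outerLeaves T).insertNone.card : ℕ) : ℝ) ≤ 3 * T.card + 2 := by
      rw [Finset.card_insertNone]
      have := card_union_outerLeaves_le T
      exact_mod_cast (by omega)
    have hsub := Finset.insertNone.monotone
      (union_outerLeaves_subset (empTree_subset_levelTree φ ψ μ z lam J))
    calc ∑ a ∈ (T ∪ outerLeaves T).insertNone, (empCoeff φ ψ μ z a - coeff φ ψ μ f a) ^ 2
        ≤ ∑ a ∈ (T ∪ outerLeaves T).insertNone, (lam / 4) ^ 2 := by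
          refine Finset.sum_le_sum fun a ha => sq_le_sq.2 ?_
          rw [abs_of_nonneg (by positivity : 0 ≤ lam / 4)]
          exact hz a (hsub ha)
      _ = (T ∪ outerLeaves T).insertNone.card * (lam / 4) ^ 2 := by simp
      _ ≤ (3 * (C * 2 ^ q * lam ^ (-q)) + 2) * (lam / 4) ^ 2 := by
          gcongr
          linarith
      _ ≤ lam ^ 2 + C * 2 ^ q * lam ^ (2 - q) := by
          have e : lam ^ (2 - q) = lam ^ (-q) * lam ^ 2 := by
            rw [sub_eq_neg_add, Real.rpow_add hlam]; norm_num
          rw [e]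
          have : 0 ≤ C * 2 ^ q * (lam ^ (-q) * lam ^ 2) := by positivity
          nlinarith [sq_nonneg lam]

end GoodEvent

/-! ### Threshold and truncation level -/

lemma bddAbove_two_pow_le (x : ℝ) : BddAbove {j : ℕ | (2 : ℝ) ^ j ≤ x} := by
  obtain ⟨N, hN⟩ := exists_nat_gt (x)
  refine ⟨N, fun j hj => ?_⟩
  have h1 : (j : ℝ) < 2 ^ j := by exact_mod_cast Nat.lt_two_pow_self
  have h2 : (j : ℝ) < N := (h1.trans_le hj).trans hN
  exact_mod_cast h2.le

lemma lt_two_pow_truncLevel_succ (γ lam : ℝ) :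
    lam ^ (-1 / γ) < (2 : ℝ) ^ (truncLevel γ lam + 1) := by
  by_contra hle
  have := le_csSup (bddAbove_two_pow_le _) (not_lt.1 hle)
  exact absurd this (Nat.not_succ_le_self _)

/-- Maximality of the truncation level, raised to the power `γ`; this turns the `𝒜^γ` bias into
`O(λ)`. -/
lemma two_rpow_neg_truncLevel_le {γ lam : ℝ} (hγ : 0 < γ) (hlam : 0 < lam) :
    (2 : ℝ) ^ (-(truncLevel γ lam * γ)) ≤ 2 ^ γ * lam := by
  have h := Real.rpow_le_rpow (by positivity) (lt_two_pow_truncLevel_succ γ lam).le hγ.le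
  rw [← Real.rpow_mul hlam.le, div_mul_cancel₀ _ hγ.ne', Real.rpow_neg_one, ← Real.rpow_natCast,
    ← Real.rpow_mul (by norm_num), Nat.cast_add, Nat.cast_one, add_mul, one_mul,
    Real.rpow_add (by norm_num)] at h
  rw [Real.rpow_neg (by norm_num), inv_le_iff_one_le_mul₀ (by positivity)]
  rw [inv_le_iff_one_le_mul₀ hlam] at h
  linarith

/-- This is where `γ ≥ 1/2` matters: `1/γ ≤ 2` gives `λ^(-1/γ) ≤ λ^(-2)` for `λ ≤ 1`. The minimum
with `1` covers `λ > 1`, where no level qualifies and the supremum of the empty set is `0`. -/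
lemma two_pow_truncLevel_mul_le {γ lam : ℝ} (hγ : 1 / 2 ≤ γ) (hlam : 0 < lam) :
    (2 : ℝ) ^ truncLevel γ lam * min lam 1 ^ 2 ≤ 1 := by
  have hγ0 : 0 < γ := by linarith
  have hm : 0 < min lam 1 := lt_min hlam one_pos
  have hm1 : min lam 1 ^ 2 ≤ 1 := pow_le_one₀ hm.le (min_le_right _ _)
  rcases Set.eq_empty_or_nonempty {j : ℕ | (2 : ℝ) ^ j ≤ lam ^ (-1 / γ)} with he | hne
  · have : truncLevel γ lam = 0 := by rw [truncLevel, he]; simp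
    rw [this]; simpa using hm1
  · have hmem : (2 : ℝ) ^ truncLevel γ lam ≤ lam ^ (-1 / γ) := Nat.sSup_mem hne (bddAbove_two_pow_le _)
    have h1 : lam ^ (-1 / γ) ≤ min lam 1 ^ (-1 / γ) :=
      Real.rpow_le_rpow_of_nonpos hm (min_le_left _ _)
        (div_nonpos_of_nonpos_of_nonneg (by norm_num) hγ0.le)
    have h2 : min lam 1 ^ (-1 / γ) ≤ min lam 1 ^ (-2 : ℝ) := by
      refine Real.rpow_le_rpow_of_exponent_ge hm (min_le_right _ _) ?_
      rw [le_div_iff₀ hγ0]; linarith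
    have h3 := hmem.trans (h1.trans h2)
    rw [Real.rpow_neg hm.le, Real.rpow_two] at h3
    calc _ ≤ (min lam 1 ^ 2)⁻¹ * min lam 1 ^ 2 := by gcongr
      _ = 1 := inv_mul_cancel₀ (by positivity)

section Threshold

variable {κ : ℝ} {n : ℕ}

lemma log_div_pos (hn : 2 ≤ n) : 0 < Real.log n / n := by
  have : (2 : ℝ) ≤ n := by exact_mod_cast hn
  exact div_pos (Real.log_pos (by linarith)) (by linarith)

lemma log_div_le_one (hn : 2 ≤ n) : Real.log n / n ≤ 1 := by
  have : (2 : ℝ) ≤ n := by exact_mod_cast hn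
  rw [div_le_one (by linarith)]
  linarith [Real.log_le_sub_one_of_pos (by linarith : (0 : ℝ) < n)]

lemma half_le_log (hn : 2 ≤ n) : 1 / 2 ≤ Real.log n := by
  have : (2 : ℝ) ≤ n := by exact_mod_cast hn
  have h := Real.log_le_log (by norm_num) this
  linarith [Real.log_two_gt_d9]

lemma threshold_pos (hκ : 0 < κ) (hn : 2 ≤ n) : 0 < threshold κ n :=
  mul_pos hκ (Real.sqrt_pos.2 (log_div_pos hn))

lemma mul_threshold_sq (hn : 2 ≤ n) : n * threshold κ n ^ 2 = κ ^ 2 * Real.log n := by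
  have : (2 : ℝ) ≤ n := by exact_mod_cast hn
  rw [threshold, mul_pow, Real.sq_sqrt (log_div_pos hn).le]
  field_simp

/-- Lower bound for the Bernstein exponent, whose free parameter is taken proportional to
`min(λ,1)`. -/
lemma mul_log_le_mul_threshold (hκ : 1 ≤ κ) (hn : 2 ≤ n) :
    κ * Real.log n ≤ n * (min (threshold κ n) 1 * threshold κ n) := by
  have hlam := threshold_pos (by linarith : 0 < κ) hn
  have hlog := half_le_log hn
  have hn2 : (2 : ℝ) ≤ n := by exact_mod_cast hn
  rcases le_total (threshold κ n) 1 with h | h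
  · rw [min_eq_left h, ← sq, mul_threshold_sq hn]
    exact mul_le_mul_of_nonneg_right (le_self_pow₀ hκ two_ne_zero) (by linarith)
  · rw [min_eq_right h, one_mul, threshold]
    have h1 : Real.log n / n ≤ Real.sqrt (Real.log n / n) :=
      Real.le_sqrt_of_sq_le (by nlinarith [log_div_le_one hn, log_div_pos hn])
    have h2 : Real.log n ≤ n * Real.sqrt (Real.log n / n) := by
      rw [div_le_iff₀ (by linarith)] at h1; linarith
    nlinarith

lemma half_le_mul_min_threshold_sq (hκ : 1 ≤ κ) (hn : 2 ≤ n) :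
    1 / 2 ≤ n * min (threshold κ n) 1 ^ 2 := by
  have hn2 : (2 : ℝ) ≤ n := by exact_mod_cast hn
  rcases le_total (threshold κ n) 1 with h | h
  · rw [min_eq_left h, mul_threshold_sq hn]
    nlinarith [half_le_log hn]
  · rw [min_eq_right h]; linarith

lemma two_pow_truncLevel_threshold_le {γ : ℝ} (hγ : 1 / 2 ≤ γ) (hκ : 1 ≤ κ) (hn : 2 ≤ n) :
    (2 : ℝ) ^ truncLevel γ (threshold κ n) ≤ 2 * n := by
  have h1 := two_pow_truncLevel_mul_le hγ (threshold_pos (by linarith : 0 < κ) hn)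
  have h2 := half_le_mul_min_threshold_sq hκ hn
  have hp : (0 : ℝ) < 2 ^ truncLevel γ (threshold κ n) := by positivity
  have hn0 : (0 : ℝ) ≤ n := Nat.cast_nonneg n
  nlinarith

lemma card_insertNone_levelTree_le {γ : ℝ} (hγ : 1 / 2 ≤ γ) (hκ : 1 ≤ κ) (hn : 2 ≤ n) :
    ((levelTree (truncLevel γ (threshold κ n) + 1)).insertNone.card : ℝ) ≤ 17 * n ^ 2 := by
  have h1 := two_pow_truncLevel_threshold_le hγ hκ hn
  generalize truncLevel γ (threshold κ n) = J at *
  have hn2 : (2 : ℝ) ≤ n := by exact_mod_cast hn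
  have h2 : ((levelTree (J + 1)).card : ℝ) ≤ 4 ^ (J + 1) := by exact_mod_cast card_levelTree_le _
  have h3 : (4 : ℝ) ^ (J + 1) = 4 * (2 ^ J) ^ 2 := by
    rw [pow_succ, ← pow_mul, mul_comm J, pow_mul]; norm_num; ring
  have h4 : ((2 : ℝ) ^ J) ^ 2 ≤ (2 * n) ^ 2 := pow_le_pow_left₀ (by positivity) h1 2
  rw [Finset.card_insertNone, Nat.cast_add, Nat.cast_one]
  nlinarith

end Threshold

/-! ### Concentration of the empirical coefficients -/

section Concentration

variable {φ ψ : ℝ → ℝ} {P : Measure (ℝ × ℝ)} [IsProbabilityMeasure P] {f : ℝ → ℝ} {K B : ℝ}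

/-- The empirical coefficients are unbiased: condition on `X` and pull out the wavelet factor. -/
lemma integral_mul_warped (h : IsWaveletBasis φ ψ) (hf : IsRegressionFunction P f)
    (hY : ∀ᵐ z ∂P, |z.2| ≤ K) {a : Option (ℕ × ℕ)} (ha : IsIndex a) :
    ∫ z, z.2 * warped φ ψ P.fst a z.1 ∂P = coeff φ ψ P.fst f a := by
  have hw := measurable_warped h P.fst ha
  obtain ⟨B, -, hB⟩ := h.exists_bound
  have hsnd : Integrable (Prod.snd : ℝ × ℝ → ℝ) P :=
    Integrable.of_bound measurable_snd.aestronglyMeasurable K hY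
  have hint : Integrable ((Prod.snd : ℝ × ℝ → ℝ) * fun z => warped φ ψ P.fst a z.1) P :=
    hsnd.mul_bdd (hw.comp measurable_fst).aestronglyMeasurable
      (Filter.Eventually.of_forall fun z => hB a ha _ (cdf_mem_Icc P.fst z.1))
  have hm : MeasurableSpace.comap (Prod.fst : ℝ × ℝ → ℝ) inferInstance ≤
      (inferInstance : MeasurableSpace (ℝ × ℝ)) := measurable_fst.comap_le
  have hsm : StronglyMeasurable[MeasurableSpace.comap (Prod.fst : ℝ × ℝ → ℝ) inferInstance]
      fun z : ℝ × ℝ => warped φ ψ P.fst a z.1 :=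
    (hw.comp (comap_measurable _)).stronglyMeasurable
  have hpull := condExp_mul_of_stronglyMeasurable_right hsm hint hsnd
  have hmap : coeff φ ψ P.fst f a = ∫ z, f z.1 * warped φ ψ P.fst a z.1 ∂P :=
    integral_map measurable_fst.aemeasurable (hf.1.mul hw).aestronglyMeasurable
  rw [hmap]
  calc ∫ z, z.2 * warped φ ψ P.fst a z.1 ∂P
      = ∫ z, (P[(Prod.snd : ℝ × ℝ → ℝ) * fun z => warped φ ψ P.fst a z.1 |
          MeasurableSpace.comap Prod.fst inferInstance]) z ∂P := (integral_condExp hm).symm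
    _ = ∫ z, f z.1 * warped φ ψ P.fst a z.1 ∂P := by
        refine integral_congr_ae ?_
        filter_upwards [hpull, hf.2] with z h1 h2
        rw [h1, Pi.mul_apply, ← h2]

lemma integral_mul_warped_sq_le (h : IsWaveletBasis φ ψ) [NullSingletonClass P.fst]
    (hY : ∀ᵐ z ∂P, |z.2| ≤ K) {a : Option (ℕ × ℕ)} (ha : IsIndex a) :
    ∫ z, (z.2 * warped φ ψ P.fst a z.1) ^ 2 ∂P ≤ K ^ 2 := by
  have hw := measurable_warped h P.fst ha
  have h1 : ∫ z, (warped φ ψ P.fst a z.1) ^ 2 ∂P = 1 := by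
    have := integral_warped_mul h P.fst ha ha
    rw [if_pos rfl] at this
    rw [← this]
    simp_rw [sq]
    exact (integral_map measurable_fst.aemeasurable (hw.mul hw).aestronglyMeasurable).symm
  -- A non-integrable function has integral `0` by convention, so the value `1` forces
  -- integrability.
  have hi : Integrable (fun z : ℝ × ℝ => K ^ 2 * (warped φ ψ P.fst a z.1) ^ 2) P :=
    Integrable.const_mul (Integrable.of_integral_ne_zero (by rw [h1]; norm_num)) _
  calc _ ≤ ∫ z, K ^ 2 * (warped φ ψ P.fst a z.1) ^ 2 ∂P := by
        refine integral_mono_of_nonneg (Filter.Eventually.of_forall fun _ => sq_nonneg _) hi ?_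
        filter_upwards [hY] with z hz
        rw [mul_pow]
        exact mul_le_mul_of_nonneg_right (sq_le_sq.2 (hz.trans (le_abs_self K))) (sq_nonneg _)
    _ = K ^ 2 := by rw [integral_const_mul, h1, mul_one]

lemma two_rpow_half_mul_le {J : ℕ} {m : ℝ} (hm : 0 ≤ m) (h : (2 : ℝ) ^ J * m ^ 2 ≤ 1) :
    (2 : ℝ) ^ ((J : ℝ) / 2) * m ≤ 1 := by
  refine (sq_le_one_iff₀ (by positivity)).1 ?_
  rw [mul_pow, ← Real.rpow_natCast (_ ^ _), ← Real.rpow_mul (by norm_num)]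
  push_cast
  rwa [div_mul_cancel₀ _ (by norm_num : (2 : ℝ) ≠ 0), Real.rpow_natCast]

/-- Each coefficient up to the truncation level is estimated up to a quarter of the threshold,
except with polynomially small probability. -/
lemma measure_empCoeff_sub_coeff_le (h : IsWaveletBasis φ ψ) [NullSingletonClass P.fst]
    (hf : IsRegressionFunction P f) (hK : 1 ≤ K) (hY : ∀ᵐ z ∂P, |z.2| ≤ K) (hB : 1 ≤ B)
    (hψB : ∀ a, IsIndex a → ∀ y ∈ Set.Icc (0 : ℝ) 1,
      |wavelet φ ψ a y| ≤ B * (2 : ℝ) ^ ((level a : ℝ) / 2))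
    {γ : ℝ} (hγ : 1 / 2 ≤ γ) {b : ℝ} (hb : 1 ≤ b) {n : ℕ} (hn : 2 ≤ n)
    {a : Option (ℕ × ℕ)} (ha : IsIndex a)
    (hlev : level a ≤ truncLevel γ (threshold (64 * K ^ 2 * B * b) n)) :
    (Measure.pi fun _ : Fin n => P)
        {z | threshold (64 * K ^ 2 * B * b) n / 4 ≤
          |empCoeff φ ψ P.fst z a - coeff φ ψ P.fst f a|}
      ≤ 2 * ENNReal.ofReal ((n : ℝ) ^ (-b)) := by
  have hK2 : 1 ≤ K ^ 2 := one_le_pow₀ hK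
  have hKB : 1 ≤ K ^ 2 * B := one_le_mul_of_one_le_of_one_le hK2 hB
  have hκ : 1 ≤ 64 * K ^ 2 * B * b := by nlinarith [one_le_mul_of_one_le_of_one_le hKB hb]
  have hκlog := mul_log_le_mul_threshold hκ hn
  have hlam := threshold_pos (by linarith : 0 < 64 * K ^ 2 * B * b) hn
  have htr := two_pow_truncLevel_mul_le hγ hlam
  set κ := 64 * K ^ 2 * B * b with hκdef
  set lam := threshold κ n
  set m := min lam 1 with hm
  have hm0 : 0 < m := lt_min hlam one_pos
  have hml : m ≤ lam := min_le_left _ _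
  have htr' := two_rpow_half_mul_le hm0.le htr
  have hw := measurable_warped h P.fst ha
  have hgm : AEMeasurable (fun z : ℝ × ℝ => z.2 * warped φ ψ P.fst a z.1) P :=
    (measurable_snd.mul (hw.comp measurable_fst)).aemeasurable
  have hbound : ∀ᵐ z ∂P, |z.2 * warped φ ψ P.fst a z.1|
      ≤ K * (B * (2 : ℝ) ^ ((truncLevel γ lam : ℝ) / 2)) := by
    filter_upwards [hY] with z hz
    rw [abs_mul]
    refine mul_le_mul hz ((hψB a ha _ (cdf_mem_Icc P.fst z.1)).trans ?_) (abs_nonneg _)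
      (by linarith)
    gcongr
    norm_num
  -- The Bernstein parameter is `t = c m`. Then `t` times the sup bound is at most `1`, and `t² K² ≤
  -- t λ/8` costs at most half of the gain `t λ/4`. What remains is at least `n c m λ/8 ≥ (c κ/8)
  -- log n = b log n`, which explains the `64` in `κ`.
  set c := (8 * K ^ 2 * B)⁻¹ with hc
  have hc0 : 0 < c := by positivity
  have hcK : c * (K * B) ≤ 1 := by
    rw [hc, inv_mul_le_iff₀ (by positivity)]
    nlinarith [mul_le_mul_of_nonneg_right (le_self_pow₀ hK two_ne_zero) (by linarith : 0 ≤ B)]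
  have hcK2 : c * K ^ 2 ≤ 1 / 8 := by
    rw [hc, inv_mul_le_iff₀ (by positivity)]
    nlinarith
  have hcκ : c * κ = 8 * b := by
    rw [hc, hκdef]
    field_simp
    norm_num
  have ht : c * m * (K * (B * (2 : ℝ) ^ ((truncLevel γ lam : ℝ) / 2))) ≤ 1 := by
    calc _ = (c * (K * B)) * ((2 : ℝ) ^ ((truncLevel γ lam : ℝ) / 2) * m) := by ring
      _ ≤ 1 := mul_le_one₀ hcK (by positivity) htr'
  have key := measure_abs_empirical_mean_ge_le (u := lam / 4) hgm hbound
    (integral_mul_warped_sq_le h hY ha) (by positivity) ht (by omega : 0 < n)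
  rw [integral_mul_warped h hf hY ha] at key
  refine key.trans ?_
  gcongr
  have hn0 : (0 : ℝ) < n := by positivity
  rw [Real.rpow_def_of_pos hn0, Real.exp_le_exp, mul_neg, neg_le_neg_iff]
  have e1 : c * m * (lam / 8) ≤ c * m * (lam / 4) - (c * m) ^ 2 * K ^ 2 := by
    have : (c * m) ^ 2 * K ^ 2 = c * m * (m * (c * K ^ 2)) := by ring
    rw [this, ← mul_sub]
    refine mul_le_mul_of_nonneg_left ?_ (by positivity)
    nlinarith
  calc Real.log n * b = c / 8 * (κ * Real.log n) := by
        rw [← mul_assoc, div_mul_eq_mul_div, hcκ]; ring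
    _ ≤ c / 8 * (n * (m * lam)) := by gcongr
    _ = n * (c * m * (lam / 8)) := by ring
    _ ≤ _ := by gcongr

/-- All coefficients up to the truncation level are estimated up to a quarter of the threshold,
except with polynomially small probability. -/
lemma measure_exists_empCoeff_sub_coeff_le (h : IsWaveletBasis φ ψ) [NullSingletonClass P.fst]
    (hf : IsRegressionFunction P f) (hK : 1 ≤ K) (hY : ∀ᵐ z ∂P, |z.2| ≤ K) (hB : 1 ≤ B)
    (hψB : ∀ a, IsIndex a → ∀ y ∈ Set.Icc (0 : ℝ) 1,
      |wavelet φ ψ a y| ≤ B * (2 : ℝ) ^ ((level a : ℝ) / 2))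
    {γ : ℝ} (hγ : 1 / 2 ≤ γ) {b : ℝ} (hb : 1 ≤ b) {n : ℕ} (hn : 2 ≤ n) :
    (Measure.pi fun _ : Fin n => P)
        {z | ∃ a ∈ (levelTree
            (truncLevel γ (threshold (64 * K ^ 2 * B * b) n) + 1)).insertNone,
          threshold (64 * K ^ 2 * B * b) n / 4 ≤
            |empCoeff φ ψ P.fst z a - coeff φ ψ P.fst f a|}
      ≤ ENNReal.ofReal (34 * (n : ℝ) ^ (2 - b)) := by
  have hK2 : 1 ≤ K ^ 2 := one_le_pow₀ hK
  have hKB : 1 ≤ K ^ 2 * B := one_le_mul_of_one_le_of_one_le hK2 hB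
  have hκ : 1 ≤ 64 * K ^ 2 * B * b := by nlinarith [one_le_mul_of_one_le_of_one_le hKB hb]
  have hcard := card_insertNone_levelTree_le hγ hκ hn
  have hone := fun a ha => measure_empCoeff_sub_coeff_le h hf hK hY hB hψB hγ hb hn
    (isIndex_of_mem (a := a) ha) (level_le_of_mem ha)
  generalize (levelTree (truncLevel γ (threshold (64 * K ^ 2 * B * b) n) + 1)).insertNone = S at *
  have hn0 : (0 : ℝ) < n := by positivity
  have hset : {z : Fin n → ℝ × ℝ | ∃ a ∈ S, threshold (64 * K ^ 2 * B * b) n / 4 ≤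
      |empCoeff φ ψ P.fst z a - coeff φ ψ P.fst f a|} = ⋃ a ∈ S,
      {z | threshold (64 * K ^ 2 * B * b) n / 4 ≤
        |empCoeff φ ψ P.fst z a - coeff φ ψ P.fst f a|} := by
    ext z; simp
  rw [hset]
  refine (measure_biUnion_finset_le _ _).trans ((Finset.sum_le_sum hone).trans ?_)
  rw [Finset.sum_const, nsmul_eq_mul, ← ENNReal.ofReal_natCast,
    show (2 : ℝ≥0∞) = ENNReal.ofReal 2 by simp, ← ENNReal.ofReal_mul (by norm_num),
    ← ENNReal.ofReal_mul (by positivity)]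
  refine ENNReal.ofReal_le_ofReal ?_
  calc (S.card : ℝ) * (2 * (n : ℝ) ^ (-b)) ≤ 17 * n ^ 2 * (2 * (n : ℝ) ^ (-b)) := by gcongr
    _ = 34 * (n : ℝ) ^ (2 - b) := by
        rw [sub_eq_add_neg, Real.rpow_add hn0, Real.rpow_two]; ring

/-- A crude bound for the error that holds almost surely. -/
lemma eLpNorm_sub_estimator_le (h : IsWaveletBasis φ ψ) [NullSingletonClass P.fst]
    (hf : MemLp f 2 P.fst) (hK : 1 ≤ K) (hY : ∀ᵐ z ∂P, |z.2| ≤ K) (hB : 1 ≤ B)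
    (hψB : ∀ a, IsIndex a → ∀ y ∈ Set.Icc (0 : ℝ) 1,
      |wavelet φ ψ a y| ≤ B * (2 : ℝ) ^ ((level a : ℝ) / 2))
    {γ κ : ℝ} (hγ : 1 / 2 ≤ γ) (hκ : 1 ≤ κ) {n : ℕ} (hn : 2 ≤ n) :
    ∀ᵐ z ∂(Measure.pi fun _ : Fin n => P),
      eLpNorm (fun x => f x - estimator φ ψ P.fst κ γ z x) 2 P.fst
        ≤ ENNReal.ofReal (((eLpNorm f 2 P.fst).toReal + 6 * (K * B)) * Real.sqrt (n ^ 3)) := by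
  have hn2 : (2 : ℝ) ≤ n := by exact_mod_cast hn
  have hall : ∀ᵐ z ∂(Measure.pi fun _ : Fin n => P), ∀ i, |(z i).2| ≤ K := by
    rw [ae_all_iff]
    exact fun i => (Measure.quasiMeasurePreserving_eval (fun _ => P) i).ae hY
  have hcard := card_insertNone_levelTree_le hγ hκ hn
  have hpow := two_pow_truncLevel_threshold_le hγ hκ hn
  filter_upwards [hall] with z hz
  unfold estimator
  have hsub := Finset.insertNone.monotone (union_outerLeaves_subset
    (empTree_subset_levelTree φ ψ P.fst z (threshold κ n) (truncLevel γ (threshold κ n))))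
  simp only [treeSum_eq]
  generalize truncLevel γ (threshold κ n) = J at *
  set S := (empTree φ ψ P.fst z (threshold κ n) J ∪
    outerLeaves (empTree φ ψ P.fst z (threshold κ n) J)).insertNone
  have hSI : ∀ a ∈ S, IsIndex a := fun a ha => isIndex_of_mem (hsub ha)
  have hcoef : ∀ a ∈ S, empCoeff φ ψ P.fst z a ^ 2 ≤ (K * B) ^ 2 * (2 * n) := by
    intro a ha
    have hw : ∀ i, |(z i).2 * warped φ ψ P.fst a (z i).1| ≤ K * (B * 2 ^ ((J : ℝ) / 2)) := by
      intro i
      rw [abs_mul]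
      refine mul_le_mul (hz i) ((hψB a (hSI a ha) _ (cdf_mem_Icc P.fst _)).trans ?_)
        (abs_nonneg _) (by linarith)
      gcongr
      · norm_num
      · exact level_le_of_mem (hsub ha)
    have habs : |empCoeff φ ψ P.fst z a| ≤ K * (B * 2 ^ ((J : ℝ) / 2)) := by
      rw [empCoeff, abs_mul, abs_of_nonneg (by positivity : (0 : ℝ) ≤ (n : ℝ)⁻¹),
        inv_mul_le_iff₀ (by linarith)]
      refine (Finset.abs_sum_le_sum_abs _ _).trans ((Finset.sum_le_sum fun i _ => hw i).trans ?_)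
      simp
    calc empCoeff φ ψ P.fst z a ^ 2 ≤ (K * (B * 2 ^ ((J : ℝ) / 2))) ^ 2 := by
          rw [← sq_abs]
          exact pow_le_pow_left₀ (abs_nonneg _) habs 2
      _ = (K * B) ^ 2 * 2 ^ J := by
          rw [← mul_assoc, mul_pow, ← Real.rpow_natCast ((2 : ℝ) ^ ((J : ℝ) / 2)),
            ← Real.rpow_mul (by norm_num)]
          push_cast
          rw [div_mul_cancel₀ _ (by norm_num : (2 : ℝ) ≠ 0), Real.rpow_natCast]
      _ ≤ _ := by gcongr
  -- At most `17 n²` terms of size `2n (K B)²`, and `34 ≤ 6²`.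
  have hsum : ∑ a ∈ S, empCoeff φ ψ P.fst z a ^ 2 ≤ (6 * (K * B)) ^ 2 * n ^ 3 := by
    calc _ ≤ ∑ a ∈ S, (K * B) ^ 2 * (2 * n) := Finset.sum_le_sum hcoef
      _ = S.card * ((K * B) ^ 2 * (2 * n)) := by simp
      _ ≤ 17 * n ^ 2 * ((K * B) ^ 2 * (2 * n)) := by
          gcongr
          refine le_trans ?_ hcard
          exact_mod_cast Finset.card_le_card hsub
      _ ≤ _ := by
          have : 0 ≤ (K * B) ^ 2 * (n : ℝ) ^ 3 := by positivity
          nlinarith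
  have hms : Measurable fun x => ∑ a ∈ S, empCoeff φ ψ P.fst z a * warped φ ψ P.fst a x :=
    Finset.measurable_fun_sum _ fun a ha => (measurable_warped h P.fst (hSI a ha)).const_mul _
  refine (eLpNorm_sub_le hf.1 hms.aestronglyMeasurable (by norm_num)).trans ?_
  rw [eLpNorm_sum_warped h P.fst S hSI, add_mul, ENNReal.ofReal_add (by positivity)
    (by positivity)]
  have hsq : 1 ≤ Real.sqrt ((n : ℝ) ^ 3) :=
    Real.one_le_sqrt.2 (one_le_pow₀ (by linarith))
  refine add_le_add ?_ (ENNReal.ofReal_le_ofReal ?_)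
  · rw [← ENNReal.ofReal_toReal hf.2.ne]
    refine ENNReal.ofReal_le_ofReal ?_
    rw [ENNReal.toReal_ofReal ENNReal.toReal_nonneg]
    exact le_mul_of_one_le_right ENNReal.toReal_nonneg hsq
  · refine (Real.sqrt_le_sqrt hsum).trans ?_
    rw [Real.sqrt_mul (sq_nonneg _), Real.sqrt_sq (by positivity)]

end Concentration

/-! ### Rates -/

section Rate

variable {s κ : ℝ} {n : ℕ}

/-- Here `2 - p = 4s/(2s+1)`, and the square root in the threshold halves this exponent. -/
lemma threshold_rpow (hs : 0 < s) (hκ : 0 ≤ κ) (hn : 2 ≤ n) :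
    threshold κ n ^ (2 - (s + 1 / 2)⁻¹)
      = κ ^ (2 - (s + 1 / 2)⁻¹) * ((Real.log n / n) ^ (s / (2 * s + 1))) ^ 2 := by
  have hx := (log_div_pos hn).le
  rw [threshold, Real.mul_rpow hκ (Real.sqrt_nonneg _), Real.sqrt_eq_rpow, ← Real.rpow_mul hx,
    ← Real.rpow_natCast (_ ^ (s / (2 * s + 1))), ← Real.rpow_mul hx]
  congr 2
  push_cast
  field_simp
  ring

lemma threshold_le (hs : 0 < s) (hκ : 0 ≤ κ) (hn : 2 ≤ n) :
    threshold κ n ≤ κ * (Real.log n / n) ^ (s / (2 * s + 1)) := by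
  rw [threshold, Real.sqrt_eq_rpow]
  refine mul_le_mul_of_nonneg_left ?_ hκ
  refine Real.rpow_le_rpow_of_exponent_ge (log_div_pos hn) (log_div_le_one hn) ?_
  rw [div_le_div_iff₀ (by positivity) (by norm_num)]
  linarith

lemma rpow_neg_one_le (hs : 0 < s) (hn : 2 ≤ n) :
    (n : ℝ) ^ (-1 : ℝ) ≤ 2 * (Real.log n / n) ^ (2 * s / (2 * s + 1)) := by
  have hx := log_div_pos hn
  have h1 : Real.log n / n ≤ (Real.log n / n) ^ (2 * s / (2 * s + 1)) := by
    conv_lhs => rw [← Real.rpow_one (Real.log n / n)]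
    refine Real.rpow_le_rpow_of_exponent_ge hx (log_div_le_one hn) ?_
    rw [div_le_one (by positivity)]
    linarith
  refine le_trans ?_ (mul_le_mul_of_nonneg_left h1 (by norm_num))
  have hn2 : (2 : ℝ) ≤ n := by exact_mod_cast hn
  rw [Real.rpow_neg_one, ← mul_div_assoc, ← one_div]
  gcongr
  linarith [half_le_log hn]

end Rate

end WarpedWavelet

open WarpedWavelet

theorem theorem2 (φ ψ : ℝ → ℝ) (hψ : WarpedWavelet.IsWaveletBasis φ ψ)
    (M β γ : ℝ) (hγ : 1 / 2 ≤ γ) :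
    ∃ κ : ℝ, 0 < κ ∧
      ∀ (P : Measure (ℝ × ℝ)) [IsProbabilityMeasure P] [NullSingletonClass P.fst] (f : ℝ → ℝ),
        (∀ᵐ z ∂P, z.1 ∈ Set.Icc (0 : ℝ) 1 ∧ z.2 ∈ Set.Icc (-M) M) →
        WarpedWavelet.IsRegressionFunction P f →
        ∀ s : ℝ, 0 < s →
          WarpedWavelet.MemA φ ψ P.fst γ f →
          WarpedWavelet.MemB φ ψ P.fst s f →
          ∃ c C : ℝ, 0 < c ∧ 0 < C ∧ ∀ n : ℕ, 2 ≤ n →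
            (Measure.pi fun _ : Fin n => P)
                {z | ENNReal.ofReal (c * (Real.log n / n) ^ (s / (2 * s + 1))) <
                  eLpNorm (fun x => f x - WarpedWavelet.estimator φ ψ P.fst κ γ z x) 2 P.fst}
              ≤ ENNReal.ofReal (C * (n : ℝ) ^ (-β)) ∧
            ∫⁻ z, eLpNorm (fun x => f x - WarpedWavelet.estimator φ ψ P.fst κ γ z x) 2 P.fst ^ 2
                ∂(Measure.pi fun _ : Fin n => P)
              ≤ ENNReal.ofReal (C * (Real.log n / n) ^ (2 * s / (2 * s + 1))) := by
  obtain ⟨B, hB, hψB⟩ := hψ.exists_bound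
  obtain ⟨K, hK, hMK⟩ : ∃ K : ℝ, 1 ≤ K ∧ M ≤ K := ⟨max 1 M, le_max_left _ _, le_max_right _ _⟩
  -- The bad event has probability at most `34 n^(2-b)`. The tail bound needs `2 - b ≤ -β`; the
  -- expectation needs `n³ n^(2-b) ≤ n^(-1)`, hence `b ≥ 6`.
  obtain ⟨b, hb6, hbβ⟩ : ∃ b : ℝ, 6 ≤ b ∧ 2 - b ≤ -β :=
    ⟨max 6 (β + 2), le_max_left _ _, by linarith [le_max_right 6 (β + 2)]⟩
  have hκ : 1 ≤ 64 * K ^ 2 * B * b := by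
    nlinarith [one_le_mul_of_one_le_of_one_le (one_le_mul_of_one_le_of_one_le
      (one_le_pow₀ hK : 1 ≤ K ^ 2) hB) (by linarith : 1 ≤ b)]
  refine ⟨64 * K ^ 2 * B * b, by linarith, ?_⟩
  intro P _ _ f hP hf s hs hA hBs
  obtain ⟨hfL, M₀, hM₀⟩ := hA
  obtain ⟨-, C₀, hC₀⟩ := hBs
  have hY : ∀ᵐ z ∂P, |z.2| ≤ K := by
    filter_upwards [hP] with z hz
    exact (abs_le.2 hz.2).trans hMK
  have hC₀0 : 0 ≤ C₀ := le_trans (by positivity) (hC₀ 1 one_pos).2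
  have hbad := fun (n : ℕ) (hn : 2 ≤ n) => measure_exists_empCoeff_sub_coeff_le hψ hf hK hY hB hψB
    hγ (by linarith : 1 ≤ b) hn
  have hcrude := fun (n : ℕ) (hn : 2 ≤ n) =>
    eLpNorm_sub_estimator_le hψ hfL hK hY hB hψB hγ hκ hn
  generalize 64 * K ^ 2 * B * b = κ at *
  have hκ0 : 0 < κ := by linarith
  set q := (s + 1 / 2)⁻¹ with hq
  have hq2 : q < 2 := by
    rw [hq, inv_lt_comm₀ (by positivity) (by norm_num)]; linarith
  set A := C₀ * 2 ^ q / (1 - 2⁻¹ ^ (2 - q)) with hAdef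
  have hA0 : 0 ≤ A := by
    have := Real.rpow_lt_one (x := (2⁻¹ : ℝ)) (by norm_num) (by norm_num)
      (by linarith : 0 < 2 - q)
    exact div_nonneg (by positivity) (by linarith)
  -- The constants of the uniform bias, the omitted residuals and the coefficient errors, in this
  -- order.
  set c₁ := |M₀| * (2 ^ γ * κ) with hc₁
  set c₂ := Real.sqrt (A * (2 ^ (2 - q) * κ ^ (2 - q))) with hc₂
  set c₃ := Real.sqrt (κ ^ 2 + C₀ * 2 ^ q * κ ^ (2 - q)) with hc₃
  set D := (eLpNorm f 2 P.fst).toReal + 6 * (K * B) with hD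
  have hc₃0 : 0 < c₃ := Real.sqrt_pos.2 (by positivity)
  have hc0 : 0 < c₁ + c₂ + c₃ := by positivity
  refine ⟨c₁ + c₂ + c₃, 34 + (c₁ + c₂ + c₃) ^ 2 + 68 * D ^ 2, hc0, by positivity, fun n hn => ?_⟩
  set x := Real.log n / n with hx
  have hx0 : 0 < x := log_div_pos hn
  set r := x ^ (s / (2 * s + 1)) with hr
  have hr0 : 0 < r := by positivity
  have hn2 : (2 : ℝ) ≤ n := by exact_mod_cast hn
  have hn0 : (0 : ℝ) < n := by linarith
  have hlam := threshold_pos hκ0 hn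
  have hlamr := threshold_le hs hκ0.le hn
  have hlamq := threshold_rpow hs hκ0.le hn
  rw [← hx, ← hr] at hlamr hlamq
  rw [← hq] at hlamq
  have hpb := hbad n hn
  have hcr := hcrude n hn
  set bad := {z : Fin n → ℝ × ℝ | ∃ a ∈ (levelTree (truncLevel γ (threshold κ n) + 1)).insertNone,
    threshold κ n / 4 ≤ |empCoeff φ ψ P.fst z a - coeff φ ψ P.fst f a|} with hbaddef
  have hgood : ∀ z ∉ bad, eLpNorm (fun x => f x - estimator φ ψ P.fst κ γ z x) 2 P.fst
      ≤ ENNReal.ofReal ((c₁ + c₂ + c₃) * r) := by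
    intro z hz
    have hz' : ∀ a ∈ (levelTree (truncLevel γ (threshold κ n) + 1)).insertNone,
        |empCoeff φ ψ P.fst z a - coeff φ ψ P.fst f a| ≤ threshold κ n / 4 := by
      intro a ha
      by_contra hlt
      exact hz ⟨a, ha, (not_le.1 hlt).le⟩
    refine (eLpNorm_sub_treeSum_empTree_le hψ hf.1 hs hC₀0 hC₀ hlam hz').trans ?_
    rw [← hq, add_mul, add_mul, ENNReal.ofReal_add (by positivity) (by positivity),
      ENNReal.ofReal_add (by positivity) (by positivity)]
    refine add_le_add (add_le_add ((hM₀ _).trans (ENNReal.ofReal_le_ofReal ?_))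
      (ENNReal.ofReal_le_ofReal ?_)) (ENNReal.ofReal_le_ofReal ?_)
    · calc M₀ * (2 : ℝ) ^ (-(truncLevel γ (threshold κ n) * γ))
          ≤ |M₀| * (2 ^ γ * threshold κ n) := by
            refine mul_le_mul (le_abs_self _) ?_ (by positivity) (abs_nonneg _)
            exact two_rpow_neg_truncLevel_le (by linarith) hlam
        _ ≤ |M₀| * (2 ^ γ * (κ * r)) := by gcongr
        _ = c₁ * r := by rw [hc₁]; ring
    · rw [← hAdef, Real.mul_rpow (by norm_num) hlam.le, hlamq, hc₂,
        show A * (2 ^ (2 - q) * (κ ^ (2 - q) * r ^ 2)) = A * (2 ^ (2 - q) * κ ^ (2 - q)) * r ^ 2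
          by ring, Real.sqrt_mul (by positivity), Real.sqrt_sq hr0.le]
    · rw [hc₃, ← Real.sqrt_sq hr0.le, ← Real.sqrt_mul (by positivity), hlamq]
      refine Real.sqrt_le_sqrt ?_
      have := pow_le_pow_left₀ hlam.le hlamr 2
      nlinarith
  constructor
  · refine (measure_mono fun z hz => ?_).trans (hpb.trans (ENNReal.ofReal_le_ofReal ?_))
    · by_contra hzb
      exact absurd (hgood z hzb) (not_le.2 hz)
    · refine mul_le_mul (by nlinarith [sq_nonneg D]) ?_ (by positivity) (by positivity)
      exact Real.rpow_le_rpow_of_exponent_le (by linarith) hbβ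
  -- On the bad event the crude bound applies, off it the rate. The indicator of `bad` is integrated
  -- only through an inequality, so measurability of `bad` is not required.
  · have hpt : ∀ᵐ z ∂(Measure.pi fun _ : Fin n => P),
        eLpNorm (fun x => f x - estimator φ ψ P.fst κ γ z x) 2 P.fst ^ 2
          ≤ ENNReal.ofReal (((c₁ + c₂ + c₃) * r) ^ 2)
            + bad.indicator (fun _ => ENNReal.ofReal (D ^ 2 * n ^ 3)) z := by
      filter_upwards [hcr] with z hz
      by_cases hzb : z ∈ bad
      · rw [Set.indicator_of_mem hzb]
        refine le_add_of_le_right ((pow_le_pow_left₀ zero_le hz 2).trans ?_)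
        rw [← ENNReal.ofReal_pow (by positivity), mul_pow, Real.sq_sqrt (by positivity)]
      · rw [Set.indicator_of_notMem hzb, add_zero, ENNReal.ofReal_pow (by positivity)]
        exact pow_le_pow_left₀ zero_le (hgood z hzb) 2
    refine (lintegral_mono_ae hpt).trans ?_
    rw [lintegral_add_left measurable_const, lintegral_const, measure_univ, mul_one]
    refine (add_le_add le_rfl ((lintegral_indicator_const_le _ _).trans
      (mul_le_mul le_rfl hpb zero_le zero_le))).trans ?_
    rw [← ENNReal.ofReal_mul (by positivity), ← ENNReal.ofReal_add (by positivity) (by positivity)]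
    refine ENNReal.ofReal_le_ofReal ?_
    have hr2 : r ^ 2 = x ^ (2 * s / (2 * s + 1)) := by
      rw [hr, ← Real.rpow_natCast, ← Real.rpow_mul hx0.le]
      congr 1; push_cast; ring
    have hpow : (n : ℝ) ^ 3 * (n : ℝ) ^ (2 - b) ≤ (n : ℝ) ^ (-1 : ℝ) := by
      rw [← Real.rpow_natCast, ← Real.rpow_add hn0]
      refine Real.rpow_le_rpow_of_exponent_le (by linarith) ?_
      push_cast; linarith
    have hn1 := hpow.trans (rpow_neg_one_le hs hn)
    rw [← hx, ← hr2] at hn1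
    rw [← hr2]
    calc ((c₁ + c₂ + c₃) * r) ^ 2 + D ^ 2 * n ^ 3 * (34 * (n : ℝ) ^ (2 - b))
        = (c₁ + c₂ + c₃) ^ 2 * r ^ 2 + 34 * D ^ 2 * (n ^ 3 * (n : ℝ) ^ (2 - b)) := by ring
      _ ≤ (c₁ + c₂ + c₃) ^ 2 * r ^ 2 + 34 * D ^ 2 * (2 * r ^ 2) := by gcongr
      _ ≤ _ := by nlinarith [sq_nonneg r]
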